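/- **Setting.** Let $N\ge 2$ and let $m,\omega_0,\eta_L,\eta_R,T_L,T_R,\hbar,k_B>0$. Put $\alpha_{a}=\eta_{a}/(2m\omega_0)$ for $a=L,R$. Consider a harmonic chain of $N$ masses with Ohmic quantum Langevin reservoirs at its two ends, $$\ddot X_1+\tfrac{\eta_L}{m}\dot X_1-\omega_0^2(X_2-X_1)=\tfrac{F_L}{m},\qquad \ddot X_j-\omega_0^2(X_{j+1}-2X_j+X_{j-1})=0\ (2\le j<N),\qquad \ddot X_N+\tfrac{\eta_R}{m}\dot X_N+\omega_0^2(X_N-X_{N-1})=\tfrac{F_R}{m}$$ for $t>0$, with an arbitrary initial configuration. Here the $X_j(t),F_a(t)$ are self-adjoint elements of a unital complex $*$-algebra with a state $\langle\cdot\rangle$, time derivatives are taken in mean square, $\langle F_a(t)\rangle=0$, and, for a frequency cutoff $\Omega>0$, $$\tfrac12\langle\{F_a(t),F_b(t')\}\rangle=\delta_{ab}\,\frac{\eta_a\hbar}{\pi}\int_0^{\Omega}\omega\coth\Big(\frac{\hbar\omega}{2k_BT_a}\Big)\cos(\omega(t'-t))\,d\omega .$$ The heat current from left to right at cutoff $\Omega$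 is $$J_\Omega=\lim_{t\to\infty}\Big[\tfrac12\langle\{\dot X_1(t),F_L(t)\}\rangle-\eta_L\langle\dot X_1(t)^2\rangle\Big]=-\lim_{t\to\infty}\Big[\tfrac12\langle\{\dot X_N(t),F_R(t)\}\rangle-\eta_R\langle\dot X_N(t)^2\rangle\Big],$$ and the stationary heat current is $J_E=\lim_{\Omega\to\infty}J_\Omega$. For real $\omega$ let $\theta=\theta(\omega)\in\mathbb C$ be any solution of $\omega=2\omega_0\sin\frac\theta2$, and set $$B(\omega)=-\cos\tfrac\theta2,\qquad A(\omega)=2i\alpha_R\sin((N-1)\theta)-\cos((N-\tfrac12)\theta),$$ $$D(\omega)=\sin(N\theta)+2i(\alpha_L+\alpha_R)\cos((N-\tfrac12)\theta)+4\alpha_L\alpha_R\sin((N-1)\theta).$$ **Claim.** 1. $D(\omega)\neq0$ for every real $\omega$ with $|\omega|\ne2\omega_0$. 2. Let $\omega$ be real with $\omega\neq0$ and $|\omega|\neq2\omega_0$. If $\tilde X_1,\dots,\tilde X_N,\tilde F_L,\tilde F_R$, elements of a complex vector space, satisfy the Fourier-transformed equations $$\omega^2\tilde X_1+\tfrac{i\omega\eta_L}{m}\tilde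 X_1+\omega_0^2(\tilde X_2-\tilde X_1)=-\tfrac{\tilde F_L}{m},\qquad \omega^2\tilde X_j+\omega_0^2(\tilde X_{j+1}-2\tilde X_j+\tilde X_{j-1})=0\ (2\le j<N),\qquad \omega^2\tilde X_N+\tfrac{i\omega\eta_R}{m}\tilde X_N+\omega_0^2(\tilde X_{N-1}-\tilde X_N)=-\tfrac{\tilde F_R}{m},$$ then $$\tilde X_1=\frac{A(\omega)\tilde F_L+B(\omega)\tilde F_R}{m\omega_0\,\omega\,D(\omega)}.$$ 3. For every real $\omega$ with $|\omega|\ne2\omega_0$, with $*$ denoting complex conjugation, $$\frac{4\alpha_LAA^*-iDA^*+iD^*A}{4\alpha_RBB^*}=-1 .$$ 4. For every $\Omega>0$ both limits $t\to\infty$ exist and agree, and the limit $\Omega\to\infty$ exists. The following integrand is absolutely integrable over $\mathbb R$, and $$J_E=\frac{2\hbar\alpha_L\alpha_R}{\pi}\int_{-\infty}^{\infty}d\omega\,\frac{\omega B(\omega)B(-\omega)}{D(\omega)D(-\omega)}\Big[\coth\frac{\hbar\omega}{2k_BT_R}-\coth\frac{\hbar\omega}{2k_BT_L}\Big];$$ moreover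 $J_\Omega$ is given by the same expression with the integral taken over $[-\Omega,\Omega]$. 5. For each of the four choices of signs $s_1,s_2\in\{1,-1\}$, let $\mathcal C$ be the contour that comes from $-\pi+i s_1\infty$ vertically to $-\pi$, runs along the real axis to $\pi$, and goes vertically to $\pi+i s_2\infty$. The following integrand is absolutely integrable along $\mathcal C$, and $$J_E=\frac{4\hbar\omega_0^2\alpha_L\alpha_R}{\pi}\int_{\mathcal C}d\theta\,\frac{\sin\frac\theta2\cos^3\frac\theta2\Big[\coth\big(\frac{\hbar\omega_0}{k_BT_L}\sin\frac\theta2\big)-\coth\big(\frac{\hbar\omega_0}{k_BT_R}\sin\frac\theta2\big)\Big]}{[\sin(N\theta)+4\alpha_L\alpha_R\sin((N-1)\theta)]^2+4(\alpha_L+\alpha_R)^2\cos^2((N-\frac12)\theta)} .$$ -/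

import Mathlib

open Filter Topology MeasureTheory
open scoped ComplexConjugate

universe u v

noncomputable section

/-! ### Parameters and the trigonometric functions of the chain -/

/-- Parameters of a harmonic chain of `N ≥ 2` equal masses `m`, with spring frequency `ω₀`, whose
first and last masses are damped (constants `ηL`, `ηR`) by reservoirs at temperatures `TL`, `TR`. -/
structure HarmonicChain where
  N : ℕ
  m : ℝ
  ω₀ : ℝ
  ηL : ℝ
  ηR : ℝ
  TL : ℝ
  TR : ℝ
  hbar : ℝ
  kB : ℝ
  two_le_N : 2 ≤ N
  m_pos : 0 < m
  ω₀_pos : 0 < ω₀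
  ηL_pos : 0 < ηL
  ηR_pos : 0 < ηR
  TL_pos : 0 < TL
  TR_pos : 0 < TR
  hbar_pos : 0 < hbar
  kB_pos : 0 < kB

/-- Real hyperbolic cotangent. -/
def realCoth (x : ℝ) : ℝ := Real.cosh x / Real.sinh x

/-- Complex hyperbolic cotangent. -/
def complexCoth (z : ℂ) : ℂ := Complex.cosh z / Complex.sinh z

namespace HarmonicChain

variable (p : HarmonicChain)

/-- Dimensionless damping constant of the left reservoir. -/
def αL : ℝ := p.ηL / (2 * p.m * p.ω₀)

/-- Dimensionless damping constant of the right reservoir. -/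
def αR : ℝ := p.ηR / (2 * p.m * p.ω₀)

/-- `B` as a function of `θ`. -/
def B (θ : ℂ) : ℂ := -Complex.cos (θ / 2)

/-- `A` as a function of `θ`. -/
def A (θ : ℂ) : ℂ :=
  2 * Complex.I * p.αR * Complex.sin (((p.N : ℂ) - 1) * θ)
    - Complex.cos (((p.N : ℂ) - 1 / 2) * θ)

/-- `D` as a function of `θ`. -/
def D (θ : ℂ) : ℂ :=
  Complex.sin ((p.N : ℂ) * θ)
    + 2 * Complex.I * (p.αL + p.αR) * Complex.cos (((p.N : ℂ) - 1 / 2) * θ)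
    + 4 * p.αL * p.αR * Complex.sin (((p.N : ℂ) - 1) * θ)

/-- `θ : ℝ → ℂ` is a choice of the implicit function defined by `ω = 2 ω₀ sin (θ / 2)`. -/
def IsBranch (θ : ℝ → ℂ) : Prop :=
  ∀ ω : ℝ, (ω : ℂ) = 2 * p.ω₀ * Complex.sin (θ ω / 2)

/-- The Langevin equations of the chain after Fourier transform in time, at the real frequency `ω`.
The amplitudes take values in a complex vector space `E`; only `X 1, …, X N` matter. -/
def FourierLangevin {E : Type v} [AddCommGroup E] [Module ℂ E]
    (ω : ℝ) (X : ℕ → E) (FL FR : E) : Prop :=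
  ((ω : ℂ) ^ 2 • X 1 + (Complex.I * ω * p.ηL / p.m) • X 1
      + (p.ω₀ : ℂ) ^ 2 • (X 2 - X 1) = -((1 / p.m : ℂ) • FL)) ∧
  (∀ j, 2 ≤ j → j < p.N →
    (ω : ℂ) ^ 2 • X j + (p.ω₀ : ℂ) ^ 2 • (X (j + 1) - (2 : ℂ) • X j + X (j - 1)) = 0) ∧
  ((ω : ℂ) ^ 2 • X p.N + (Complex.I * ω * p.ηR / p.m) • X p.N
      + (p.ω₀ : ℂ) ^ 2 • (X (p.N - 1) - X p.N) = -((1 / p.m : ℂ) • FR))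

/-- Symmetrized correlation at time lag `τ` of the force of an Ohmic reservoir with spectral
function `η ω 1_{ω ≤ Ω}`, damping `η` and temperature `T`. -/
def noiseCorrelation (η T Ω τ : ℝ) : ℝ :=
  η * p.hbar / Real.pi *
    ∫ ω in (0 : ℝ)..Ω, ω * realCoth (p.hbar * ω / (2 * p.kB * T)) * Real.cos (ω * τ)

end HarmonicChain

/-! ### Observables, states and the quantum Langevin dynamics -/

/-- A state (normalized positive linear functional) on a unital complex `*`-algebra. No norm is
required, so that algebras of unbounded operators on a common domain are included. -/
structure StarState (𝒜 : Type u) [Ring 𝒜] [StarRing 𝒜] [Algebra ℂ 𝒜] where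
  toFun : 𝒜 →ₗ[ℂ] ℂ
  map_one : toFun 1 = 1
  nonneg : ∀ a, 0 ≤ (toFun (star a * a)).re ∧ (toFun (star a * a)).im = 0

namespace StarState

variable {𝒜 : Type u} [Ring 𝒜] [StarRing 𝒜] [Algebra ℂ 𝒜] (φ : StarState 𝒜)

/-- `⟨{a, b}⟩ / 2`. -/
def sym (a b : 𝒜) : ℂ := φ.toFun (a * b + b * a) / 2

/-- The curve `Y` has derivative `Z` at time `t` in mean square. -/
def HasMeanSquareDerivAt (Y : ℝ → 𝒜) (Z : 𝒜) (t : ℝ) : Prop :=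
  Tendsto (fun h : ℝ =>
      (φ.toFun (star ((h⁻¹ : ℂ) • (Y (t + h) - Y t) - Z)
        * ((h⁻¹ : ℂ) • (Y (t + h) - Y t) - Z))).re)
    (𝓝[≠] 0) (𝓝 0)

end StarState

/-- A solution on `t > 0` of the quantum Langevin equations of the chain `p`, with centred forces
`FL`, `FR` whose symmetrized correlations are those of independent Ohmic reservoirs with
high-frequency cutoff `Ω`. `X j`, `V j`, `W j` (`1 ≤ j ≤ N`) are position, velocity and acceleration
of the `j`-th mass. Nothing is assumed about the initial configuration. -/
structure LangevinDynamics (p : HarmonicChain) (Ω : ℝ)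
    (𝒜 : Type u) [Ring 𝒜] [StarRing 𝒜] [Algebra ℂ 𝒜] where
  state : StarState 𝒜
  X : ℕ → ℝ → 𝒜
  V : ℕ → ℝ → 𝒜
  W : ℕ → ℝ → 𝒜
  FL : ℝ → 𝒜
  FR : ℝ → 𝒜
  X_selfAdjoint : ∀ j t, IsSelfAdjoint (X j t)
  V_selfAdjoint : ∀ j t, IsSelfAdjoint (V j t)
  FL_selfAdjoint : ∀ t, IsSelfAdjoint (FL t)
  FR_selfAdjoint : ∀ t, IsSelfAdjoint (FR t)
  FL_mean : ∀ t, state.toFun (FL t) = 0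
  FR_mean : ∀ t, state.toFun (FR t) = 0
  FL_corr : ∀ t t', state.sym (FL t) (FL t') = p.noiseCorrelation p.ηL p.TL Ω (t' - t)
  FR_corr : ∀ t t', state.sym (FR t) (FR t') = p.noiseCorrelation p.ηR p.TR Ω (t' - t)
  FL_FR_corr : ∀ t t', state.sym (FL t) (FR t') = 0
  X_deriv : ∀ j, 1 ≤ j → j ≤ p.N → ∀ t, 0 < t → state.HasMeanSquareDerivAt (X j) (V j t) t
  V_deriv : ∀ j, 1 ≤ j → j ≤ p.N → ∀ t, 0 < t → state.HasMeanSquareDerivAt (V j) (W j t) t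
  eq_left : ∀ t, 0 < t →
    W 1 t + (p.ηL / p.m : ℂ) • V 1 t - (p.ω₀ : ℂ) ^ 2 • (X 2 t - X 1 t) = (1 / p.m : ℂ) • FL t
  eq_bulk : ∀ j, 2 ≤ j → j < p.N → ∀ t, 0 < t →
    W j t - (p.ω₀ : ℂ) ^ 2 • (X (j + 1) t - (2 : ℂ) • X j t + X (j - 1) t) = 0
  eq_right : ∀ t, 0 < t →
    W p.N t + (p.ηR / p.m : ℂ) • V p.N t + (p.ω₀ : ℂ) ^ 2 • (X p.N t - X (p.N - 1) t)
      = (1 / p.m : ℂ) • FR t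

namespace LangevinDynamics

variable {p : HarmonicChain} {Ω : ℝ} {𝒜 : Type u} [Ring 𝒜] [StarRing 𝒜] [Algebra ℂ 𝒜]

/-- Rate `⟨{Ẋ₁, F_L}⟩ / 2 - η_L ⟨Ẋ₁²⟩` at which the left reservoir gives energy to the chain. -/
def powerLeft (S : LangevinDynamics p Ω 𝒜) (t : ℝ) : ℂ :=
  S.state.sym (S.V 1 t) (S.FL t) - p.ηL * S.state.toFun (S.V 1 t * S.V 1 t)

/-- Rate `⟨{Ẋ_N, F_R}⟩ / 2 - η_R ⟨Ẋ_N²⟩` at which the right reservoir gives energy to the chain. -/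
def powerRight (S : LangevinDynamics p Ω 𝒜) (t : ℝ) : ℂ :=
  S.state.sym (S.V p.N t) (S.FR t) - p.ηR * S.state.toFun (S.V p.N t * S.V p.N t)

end LangevinDynamics

namespace HarmonicChain

variable (p : HarmonicChain)

/-- `J` is the long-time heat current from left to right at noise cutoff `Ω`: for every solution of
the Langevin equations, whatever its initial configuration, the power supplied by the left reservoir
and the power absorbed by the right one both converge to `J`. -/
def IsCutoffHeatCurrent (Ω J : ℝ) : Prop :=
  ∀ (𝒜 : Type u) [Ring 𝒜] [StarRing 𝒜] [Algebra ℂ 𝒜] [StarModule ℂ 𝒜]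
    (S : LangevinDynamics p Ω 𝒜),
    Tendsto S.powerLeft atTop (𝓝 (J : ℂ)) ∧
    Tendsto (fun t => -S.powerRight t) atTop (𝓝 (J : ℂ))

/-! ### The two integral expressions -/

/-- Integrand of the heat current in the frequency `ω`, for a branch `θ`. -/
def fluxIntegrand (θ : ℝ → ℂ) (ω : ℝ) : ℂ :=
  (ω * B (θ ω) * B (θ (-ω))) / (p.D (θ ω) * p.D (θ (-ω))) *
    ((realCoth (p.hbar * ω / (2 * p.kB * p.TR)) : ℂ)
      - (realCoth (p.hbar * ω / (2 * p.kB * p.TL)) : ℂ))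

/-- Integrand of the heat current in the complex variable `θ`. -/
def contourIntegrand (θ : ℂ) : ℂ :=
  Complex.sin (θ / 2) * Complex.cos (θ / 2) ^ 3 *
      (complexCoth (p.hbar * p.ω₀ / (p.kB * p.TL) * Complex.sin (θ / 2))
        - complexCoth (p.hbar * p.ω₀ / (p.kB * p.TR) * Complex.sin (θ / 2))) /
    ((Complex.sin ((p.N : ℂ) * θ) + 4 * p.αL * p.αR * Complex.sin (((p.N : ℂ) - 1) * θ)) ^ 2
      + 4 * ((p.αL : ℂ) + p.αR) ^ 2 * Complex.cos (((p.N : ℂ) - 1 / 2) * θ) ^ 2)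

end HarmonicChain

/-- Absolute integrability of `g` on the three legs of the contour that comes from
`-π + i s₁ ∞` down (or up) to `-π`, runs along the real axis to `π`, and then goes to
`π + i s₂ ∞`, where `s₁, s₂ = ±1`. -/
def ContourIntegrable (g : ℂ → ℂ) (s₁ s₂ : ℝ) : Prop :=
  IntegrableOn (fun ξ : ℝ => g (-Real.pi + Complex.I * s₁ * ξ)) (Set.Ioi 0) ∧
  IntervalIntegrable (fun x : ℝ => g x) volume (-Real.pi) Real.pi ∧
  IntegrableOn (fun ξ : ℝ => g (Real.pi + Complex.I * s₂ * ξ)) (Set.Ioi 0)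

/-- The integral of `g` along the contour described in `ContourIntegrable`. -/
def contourIntegral (g : ℂ → ℂ) (s₁ s₂ : ℝ) : ℂ :=
  -(Complex.I * s₁ * ∫ ξ in Set.Ioi (0 : ℝ), g (-Real.pi + Complex.I * s₁ * ξ))
    + (∫ x in (-Real.pi)..Real.pi, g x)
    + Complex.I * s₂ * ∫ ξ in Set.Ioi (0 : ℝ), g (Real.pi + Complex.I * s₂ * ξ)

end

/-! Interleave velocities and rescaled bond lengths in spatial order: `z (2j+1)` is the velocity of
mass `j+1` and `z (2j+2)` is `ω₀` times the bond to its right. The chain becomes the first-order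
nearest-neighbour system `z (k+1)' = ω₀ (z (k+2) - z k)`, closed by zeros at `0` and `rank + 2`,
with damping and forcing only at the two end velocities. At frequency `ω` it is a three-term
recursion with `s = ω / (2 ω₀) = sin (θ/2)`, solved by `chainPoly`. The functions `A`, `B`, `D` are
`cos (θ/2)` times polynomials in `s`, up to constants (`A_eq_chainNum`, `D_eq_chainDen`), so no
branch of `θ` matters off the band edges.

The algebraic core is `chainNum_mul_conj_chainDen`, a consequence of the Cassini identity. It is the
cancellation identity; it bounds `|chainDen|²` below by `16 αL αR`; and it expresses energy balance
at each end: the power fed in by a force equals the local dissipation plus the transmitted power.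

For the long-time limit, pairing the operator equations with a fixed element `c` gives scalar
equations (`motion_mode`). Explicit Fourier integrals (`corrL`, `corrR`, `corrZ`) solve the same
equations with stationary correlations. The difference from the true correlations is unforced or
weakly forced, and decays exponentially by `exists_chain_stability`, whose proof uses a Lyapunov
function: the energy minus a small weighted virial. Hence the initial data are forgotten, and energy
balance reduces the limiting power to an integral of transmission times a difference of noise
spectra.

The resulting density `flux` is even and integrable: `ω coth (c ω)` differs from `|ω|` by an
exponentially small term, so the linear growth cancels between the reservoirs. This removes the
cutoff. The substitution `ω = 2 ω₀ sin (θ/2)` sends the contour onto the whole real `ω` axis, which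
gives the last formula. -/

noncomputable section

/-! ### The three-term recursion of the chain -/

/-- Fundamental solution of the recursion `y (k + 2) = y k - 2 i s y (k + 1)`. -/
def chainPoly (s : ℂ) : ℕ → ℂ
  | 0 => 0
  | 1 => 1
  | k + 2 => chainPoly s k - 2 * Complex.I * s * chainPoly s (k + 1)

@[simp] lemma chainPoly_zero (s : ℂ) : chainPoly s 0 = 0 := rfl
@[simp] lemma chainPoly_one (s : ℂ) : chainPoly s 1 = 1 := rfl

lemma chainPoly_add_two (s : ℂ) (k : ℕ) :
    chainPoly s (k + 2) = chainPoly s k - 2 * Complex.I * s * chainPoly s (k + 1) := rfl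

lemma continuous_chainPoly (k : ℕ) : Continuous fun s => chainPoly s k := by
  induction k using Nat.twoStepInduction with
  | zero => exact continuous_const
  | one => exact continuous_const
  | more k h0 h1 => simp only [chainPoly_add_two]; fun_prop

/-- The characteristic roots at `s = sin (θ/2)` are `exp (-iθ/2)` and `-exp (iθ/2)`, with difference
`2 cos (θ/2)`. Keeping this factor on the left makes the formulas valid at the band edges too. -/
lemma chainPoly_trig (θ : ℂ) (k : ℕ) :
    chainPoly (Complex.sin (θ / 2)) (2 * k) * Complex.cos (θ / 2)
        = -Complex.I * Complex.sin (k * θ) ∧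
      chainPoly (Complex.sin (θ / 2)) (2 * k + 1) * Complex.cos (θ / 2)
        = Complex.cos ((k + 1 / 2) * θ) := by
  induction k with
  | zero => simp [div_eq_inv_mul]
  | succ k ih =>
    obtain ⟨h0, h1⟩ := ih
    have e0 : chainPoly (Complex.sin (θ / 2)) (2 * (k + 1)) * Complex.cos (θ / 2)
        = -Complex.I * Complex.sin (((k + 1 : ℕ) : ℂ) * θ) := by
      rw [show 2 * (k + 1) = 2 * k + 2 by ring, chainPoly_add_two, sub_mul, h0, mul_assoc, h1,
        show (((k + 1 : ℕ) : ℂ) * θ) = (k + 1 / 2) * θ + θ / 2 by push_cast; ring,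
        show (k : ℂ) * θ = (k + 1 / 2) * θ - θ / 2 by ring, Complex.sin_sub, Complex.sin_add]
      ring
    refine ⟨e0, ?_⟩
    rw [show 2 * (k + 1) + 1 = (2 * k + 1) + 2 by ring, chainPoly_add_two, sub_mul, h1, mul_assoc,
      show 2 * k + 1 + 1 = 2 * (k + 1) by ring, e0,
      show (((k + 1 : ℕ) : ℂ) + 1 / 2) * θ = ((k + 1 : ℕ) : ℂ) * θ + θ / 2 by push_cast; ring,
      show ((k : ℂ) + 1 / 2) * θ = ((k + 1 : ℕ) : ℂ) * θ - θ / 2 by push_cast; ring,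
      Complex.cos_sub, Complex.cos_add]
    linear_combination (2 * Complex.sin (θ / 2) * Complex.sin (((k + 1 : ℕ) : ℂ) * θ))
      * Complex.I_mul_I

/-- Discrete Wronskian: the product of the characteristic roots is `-1`, so it only changes sign at
each step. -/
lemma chainPoly_cassini (s : ℂ) (k : ℕ) :
    chainPoly s (k + 1) ^ 2 - chainPoly s (k + 2) * chainPoly s k = (-1) ^ k := by
  induction k with
  | zero => simp
  | succ k ih =>
    rw [pow_succ (-1 : ℂ) k, ← ih, chainPoly_add_two s (k + 1), chainPoly_add_two s k]
    ring

lemma chainPoly_neg (s : ℂ) (k : ℕ) :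
    chainPoly (-s) k = (-1) ^ (k + 1) * chainPoly s k := by
  induction k using Nat.twoStepInduction with
  | zero => simp
  | one => simp
  | more k h0 h1 => rw [chainPoly_add_two, chainPoly_add_two, h0, h1]; ring

/-- Combined with `chainPoly_neg`, this makes the values real at odd indices and imaginary at even
ones, which is what the cancellation identity uses. -/
lemma conj_chainPoly (s : ℝ) (k : ℕ) : conj (chainPoly s k) = chainPoly (-s) k := by
  induction k using Nat.twoStepInduction with
  | zero => simp
  | one => simp
  | more k h0 h1 =>
    rw [chainPoly_add_two, chainPoly_add_two, ← h0, ← h1]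
    simp [Complex.conj_ofNat]

/-- Any solution of the recursion, in a complex vector space, is a combination of two
consecutive fundamental solutions. -/
lemma recursion_eq_chainPoly {E : Type*} [AddCommGroup E] [Module ℂ E] (s : ℂ) (y : ℕ → E) (n : ℕ)
    (h : ∀ k < n, y (k + 2) = y k - (2 * Complex.I * s) • y (k + 1)) :
    ∀ k ≤ n, y (k + 1) = chainPoly s (k + 1) • y 1 + chainPoly s k • y 0 := by
  intro k
  induction k using Nat.strong_induction_on with
  | _ k ih =>
    intro hk
    match k, ih, hk with
    | 0, _, _ => simp
    | 1, _, hk => 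
      rw [h 0 (by omega)]
      simp [chainPoly_add_two]
      abel
    | k + 2, ih, hk =>
      rw [h (k + 1) (by omega), ih k (by omega) (by omega), ih (k + 1) (by omega) (by omega),
        chainPoly_add_two s (k + 1), chainPoly_add_two s k]
      module

/-! ### Numerator, characteristic function and energy balance -/

/-- Response numerator of a chain with a boundary damping `β`. -/
def chainNum (r : ℕ) (β : ℝ) (s : ℂ) : ℂ := chainPoly s (r + 1) + 2 * β * chainPoly s r

/-- Characteristic function of a chain with boundary dampings `α`, `β`. -/
def chainDen (r : ℕ) (α β : ℝ) (s : ℂ) : ℂ :=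
  chainPoly s (r + 2) + 2 * (α + β) * chainPoly s (r + 1) + 4 * α * β * chainPoly s r

lemma chainDen_comm (r : ℕ) (α β : ℝ) (s : ℂ) : chainDen r α β s = chainDen r β α s := by
  unfold chainDen; ring

lemma continuous_chainNum (r : ℕ) (β : ℝ) : Continuous (chainNum r β) := by
  have h0 := continuous_chainPoly r
  have h1 := continuous_chainPoly (r + 1)
  unfold chainNum; fun_prop

lemma continuous_chainDen (r : ℕ) (α β : ℝ) : Continuous (chainDen r α β) := by
  have h0 := continuous_chainPoly r
  have h1 := continuous_chainPoly (r + 1)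
  have h2 := continuous_chainPoly (r + 2)
  unfold chainDen; fun_prop

lemma conj_chainDen (r : ℕ) (α β : ℝ) (s : ℝ) :
    conj (chainDen r α β s) = chainDen r α β (-s) := by
  simp [chainDen, conj_chainPoly, Complex.conj_ofReal, Complex.conj_ofNat]

/-- For even `r`, conjugation fixes the entry `r + 1` and negates the entries `r` and `r + 2`. All
products cancel except `4 β` times the Cassini expression. -/
lemma chainNum_mul_conj_chainDen {r : ℕ} (hr : Even r) (α β s : ℝ) :
    chainNum r β s * conj (chainDen r α β s) + conj (chainNum r β s) * chainDen r α β s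
      = 4 * α * (chainNum r β s * conj (chainNum r β s)) + 4 * β := by
  have hc := chainPoly_cassini s r
  have e0 := chainPoly_neg s r
  have e1 := chainPoly_neg s (r + 1)
  have e2 := chainPoly_neg s (r + 2)
  have h1 : (-1 : ℂ) ^ r = 1 := hr.neg_one_pow
  simp only [pow_succ, h1] at e0 e1 e2 hc
  simp only [chainNum, chainDen, map_add, map_mul, conj_chainPoly, Complex.conj_ofReal, e0, e1, e2,
    Complex.conj_ofNat]
  linear_combination 4 * β * hc

lemma re_chainNum_mul_conj_chainDen {r : ℕ} (hr : Even r) (α β s : ℝ) :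
    (chainNum r β s * conj (chainDen r α β s)).re
      = 2 * α * Complex.normSq (chainNum r β s) + 2 * β := by
  have h := congrArg Complex.re (chainNum_mul_conj_chainDen hr α β s)
  rw [Complex.mul_conj] at h
  simp at h
  simp
  linarith

/-- With `x = |chainNum|²`, the previous identity and Cauchy-Schwarz give `(2αx + 2β)² ≤ x
|chainDen|²`, while `(2αx + 2β)² ≥ 16αβx`. The bound is uniform in `s`, so it serves both
non-vanishing and integrability. -/
lemma chainDen_normSq_ge {r : ℕ} (hr : Even r) {α β : ℝ} (hβ : 0 < β) (s : ℝ) :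
    16 * α * β ≤ Complex.normSq (chainDen r α β s) := by
  have h := re_chainNum_mul_conj_chainDen hr α β s
  have h1 : (chainNum r β s * conj (chainDen r α β s)).re ^ 2
      ≤ Complex.normSq (chainNum r β s) * Complex.normSq (chainDen r α β s) := by
    rw [← Complex.normSq_conj (chainDen r α β s), ← Complex.normSq_mul, Complex.normSq_apply]
    nlinarith [sq_nonneg (chainNum r β s * conj (chainDen r α β s)).im]
  rw [h] at h1
  set x := Complex.normSq (chainNum r β s)
  have hx : 0 ≤ x := Complex.normSq_nonneg _
  -- The case `x = 0` is impossible: it would force `(2β)² ≤ 0`.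
  rcases hx.eq_or_lt with hx | hx
  · rw [← hx] at h1
    nlinarith
  · by_contra! hlt
    nlinarith [sq_nonneg (2 * α * x - 2 * β)]

lemma chainDen_ne_zero {r : ℕ} (hr : Even r) {α β : ℝ} (hα : 0 < α) (hβ : 0 < β) (s : ℝ) :
    chainDen r α β s ≠ 0 := by
  intro h
  have := chainDen_normSq_ge hr (α := α) hβ s
  rw [h] at this
  simp at this
  nlinarith [mul_pos hα hβ]

/-! ### From `θ` to the recursion: `A`, `D` and the cancellation identity -/

namespace HarmonicChain

variable (p : HarmonicChain)

/-- Number of velocities and bond lengths of the chain, minus one. -/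
def rank : ℕ := 2 * (p.N - 1)

/-- Characteristic function of the chain in terms of `ω`. -/
def den (ω : ℝ) : ℂ := chainDen p.rank p.αL p.αR (ω / (2 * p.ω₀) : ℝ)

lemma even_rank : Even p.rank := even_two_mul _

lemma two_le_rank : 2 ≤ p.rank := by have := p.two_le_N; unfold rank; omega

lemma αL_pos : 0 < p.αL := by
  have := p.m_pos; have := p.ω₀_pos; have := p.ηL_pos; unfold αL; positivity

lemma αR_pos : 0 < p.αR := by
  have := p.m_pos; have := p.ω₀_pos; have := p.ηR_pos; unfold αR; positivity

lemma den_ne_zero (ω : ℝ) : p.den ω ≠ 0 := chainDen_ne_zero p.even_rank p.αL_pos p.αR_pos _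

lemma continuous_den : Continuous p.den :=
  (continuous_chainDen _ _ _).comp (by fun_prop)

/-- Isolates the only source of zeros of `D` at real frequency, the factor `cos (θ/2)`; the rest
depends on `θ` through `sin (θ/2)` alone. -/
lemma D_eq_chainDen (θ : ℂ) :
    p.D θ = Complex.I * Complex.cos (θ / 2)
      * chainDen p.rank p.αL p.αR (Complex.sin (θ / 2)) := by
  obtain ⟨M, hM⟩ : ∃ M, p.N = M + 1 := ⟨p.N - 1, by have := p.two_le_N; omega⟩
  obtain ⟨h0, h1⟩ := chainPoly_trig θ M
  obtain ⟨h2, -⟩ := chainPoly_trig θ (M + 1)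
  rw [show 2 * (M + 1) = 2 * M + 2 by ring] at h2
  simp only [D, chainDen, rank, hM, Nat.add_sub_cancel]
  push_cast at *
  rw [show ((M : ℂ) + 1 - 1) = M by ring, show (M : ℂ) + 1 - 1 / 2 = M + 1 / 2 by ring, ← h1]
  linear_combination (-Complex.I) * h2 - 4 * Complex.I * p.αL * p.αR * h0
    + (Complex.sin ((M + 1) * θ) + 4 * p.αL * p.αR * Complex.sin (M * θ)) * Complex.I_mul_I

lemma A_eq_chainNum (θ : ℂ) :
    p.A θ = -Complex.cos (θ / 2) * chainNum p.rank p.αR (Complex.sin (θ / 2)) := by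
  obtain ⟨M, hM⟩ : ∃ M, p.N = M + 1 := ⟨p.N - 1, by have := p.two_le_N; omega⟩
  obtain ⟨h0, h1⟩ := chainPoly_trig θ M
  simp only [A, chainNum, rank, hM, Nat.add_sub_cancel]
  push_cast at *
  rw [show ((M : ℂ) + 1 - 1) = M by ring, show (M : ℂ) + 1 - 1 / 2 = M + 1 / 2 by ring, ← h1]
  linear_combination 2 * p.αR * h0

variable {p} in
lemma IsBranch.sin_eq {θ : ℝ → ℂ} (hθ : p.IsBranch θ) (ω : ℝ) :
    Complex.sin (θ ω / 2) = (ω / (2 * p.ω₀) : ℝ) := by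
  have h : (p.ω₀ : ℂ) ≠ 0 := by exact_mod_cast p.ω₀_pos.ne'
  have := hθ ω
  push_cast
  rw [this]
  field_simp

variable {p} in
lemma IsBranch.cos_ne_zero {θ : ℝ → ℂ} (hθ : p.IsBranch θ) {ω : ℝ} (hω : |ω| ≠ 2 * p.ω₀) :
    Complex.cos (θ ω / 2) ≠ 0 := by
  intro h
  have h1 := Complex.sin_sq_add_cos_sq (θ ω / 2)
  have h0 := p.ω₀_pos
  rw [h, hθ.sin_eq] at h1
  rw [zero_pow two_ne_zero, add_zero] at h1
  norm_cast at h1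
  apply hω
  rw [← abs_of_pos (show 0 < 2 * p.ω₀ by linarith), ← sq_eq_sq_iff_abs_eq_abs]
  field_simp at h1
  linarith

variable {p} in
lemma IsBranch.D_eq {θ : ℝ → ℂ} (hθ : p.IsBranch θ) (ω : ℝ) :
    p.D (θ ω) = Complex.I * Complex.cos (θ ω / 2) * p.den ω := by
  rw [D_eq_chainDen, hθ.sin_eq, den]

variable {p} in
lemma IsBranch.D_ne_zero {θ : ℝ → ℂ} (hθ : p.IsBranch θ) {ω : ℝ} (hω : |ω| ≠ 2 * p.ω₀) :
    p.D (θ ω) ≠ 0 := by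
  rw [hθ.D_eq]
  exact mul_ne_zero (mul_ne_zero Complex.I_ne_zero (hθ.cos_ne_zero hω)) (p.den_ne_zero ω)

variable {p} in
lemma IsBranch.cancellation {θ : ℝ → ℂ} (hθ : p.IsBranch θ) {ω : ℝ} (hω : |ω| ≠ 2 * p.ω₀) :
    (4 * p.αL * p.A (θ ω) * conj (p.A (θ ω))
          - Complex.I * p.D (θ ω) * conj (p.A (θ ω))
          + Complex.I * conj (p.D (θ ω)) * p.A (θ ω))
        / (4 * p.αR * HarmonicChain.B (θ ω) * conj (HarmonicChain.B (θ ω))) = -1 := by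
  have hc := hθ.cos_ne_zero hω
  have hc' : conj (Complex.cos (θ ω / 2)) ≠ 0 := by simpa using hc
  have hR : (p.αR : ℂ) ≠ 0 := by exact_mod_cast p.αR_pos.ne'
  have key := chainNum_mul_conj_chainDen p.even_rank p.αL p.αR (ω / (2 * p.ω₀))
  rw [hθ.D_eq, A_eq_chainNum, hθ.sin_eq, den, B, div_eq_iff]
  · simp only [map_mul, map_neg, Complex.conj_I]
    linear_combination (-(Complex.cos (θ ω / 2) * conj (Complex.cos (θ ω / 2)))) * key
      + (Complex.cos (θ ω / 2) * conj (Complex.cos (θ ω / 2))) *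
        (chainNum p.rank p.αR (ω / (2 * p.ω₀) : ℝ)
            * conj (chainDen p.rank p.αL p.αR (ω / (2 * p.ω₀) : ℝ))
          + conj (chainNum p.rank p.αR (ω / (2 * p.ω₀) : ℝ))
            * chainDen p.rank p.αL p.αR (ω / (2 * p.ω₀) : ℝ)) * Complex.I_mul_I
  · simp only [map_neg]
    have := neg_ne_zero.2 hc
    have := neg_ne_zero.2 hc'
    simp_all

end HarmonicChain

/-! ### Exponential stability of the damped chain -/

/-- The equations of motion of a damped chain, in terms of `z 1, …, z (r + 1)`, with velocity scale
`w`, boundary dampings `a`, `b` and boundary forces `fl`, `fr`. -/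
structure ChainODE (r : ℕ) (w a b : ℝ) (z : ℕ → ℝ → ℝ) (fl fr : ℝ → ℝ) : Prop where
  left : ∀ t, z 0 t = 0
  right : ∀ t, z (r + 2) t = 0
  deriv : ∀ k ≤ r, ∀ t, 0 < t → HasDerivAt (z (k + 1))
    (w * (z (k + 2) t - z k t) + (if k = 0 then fl t - a * z 1 t else 0)
      + (if k = r then fr t - b * z (r + 1) t else 0)) t

lemma ChainODE.sub {r : ℕ} {w a b : ℝ} {z z' : ℕ → ℝ → ℝ} {fl fr fl' fr' : ℝ → ℝ}
    (h : ChainODE r w a b z fl fr) (h' : ChainODE r w a b z' fl' fr') :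
    ChainODE r w a b (fun k t => z k t - z' k t) (fun t => fl t - fl' t)
      (fun t => fr t - fr' t) where
  left t := by simp [h.left, h'.left]
  right t := by simp [h.right, h'.right]
  deriv k hk t ht := by
    refine ((h.deriv k hk t ht).sub (h'.deriv k hk t ht)).congr_deriv ?_
    split_ifs <;> ring

lemma sum_by_parts (e g : ℕ → ℝ) (r : ℕ) :
    ∑ k ∈ Finset.range r, e (k + 1) * (g (k + 1) - g k)
      = e (r + 1) * g r - e 1 * g 0
        + ∑ k ∈ Finset.range r, (e (k + 1) - e (k + 2)) * g (k + 1) := by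
  induction r with
  | zero => simp
  | succ r ih => rw [Finset.sum_range_succ, Finset.sum_range_succ, ih]; ring

/-- A log-convex weight. -/
def chainWeight (k : ℕ) : ℝ := 2 ^ (k ^ 2)

lemma one_le_chainWeight (k : ℕ) : 1 ≤ chainWeight k := one_le_pow₀ (by norm_num)

lemma chainWeight_mul (k : ℕ) :
    chainWeight k * chainWeight (k + 2) = 4 * chainWeight (k + 1) ^ 2 := by
  unfold chainWeight
  rw [← pow_add, ← pow_mul, show (4 : ℝ) = 2 ^ 2 by norm_num, ← pow_add]
  congr 1
  ring

/-- A completed square; the factor `4` in `chainWeight_mul` is what lowers the price to a quarter of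
each neighbouring weight, so that two such sums use only half of the diagonal. -/
lemma chainWeight_cross (k : ℕ) (x y : ℝ) :
    -(chainWeight (k + 1) * (x * y)) ≤ (chainWeight k * x ^ 2 + chainWeight (k + 2) * y ^ 2) / 4 := by
  have h := chainWeight_mul k
  have h0 : 0 < chainWeight k := by linarith [one_le_chainWeight k]
  have : 0 ≤ (chainWeight k * x + 2 * chainWeight (k + 1) * y) ^ 2 / chainWeight k := by positivity
  have e : (chainWeight k * x + 2 * chainWeight (k + 1) * y) ^ 2 / chainWeight k
      = chainWeight k * x ^ 2 + 4 * chainWeight (k + 1) * (x * y) + chainWeight (k + 2) * y ^ 2 := by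
    field_simp
    linear_combination -(y ^ 2) * h
  linarith

/-- Tail sums of the weight up to `r + 1`. -/
def chainTail (r k : ℕ) : ℝ := ∑ j ∈ Finset.Ico (k + 1) (r + 2), chainWeight j

lemma chainTail_last (r : ℕ) : chainTail r (r + 1) = 0 := by simp [chainTail]

/-- The virial carries tail sums so that summation by parts in its derivative reproduces the weights
themselves. -/
lemma chainTail_sub {r k : ℕ} (hk : k < r) :
    chainTail r (k + 1) - chainTail r (k + 2) = chainWeight (k + 2) := by
  unfold chainTail
  rw [Finset.sum_eq_sum_Ico_succ_bot (by omega)]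
  ring

lemma chainTail_nonneg (r k : ℕ) : 0 ≤ chainTail r k :=
  Finset.sum_nonneg fun j _ => by linarith [one_le_chainWeight j]

lemma chainTail_le {r k l : ℕ} (h : k ≤ l) : chainTail r l ≤ chainTail r k :=
  Finset.sum_le_sum_of_subset_of_nonneg (Finset.Ico_subset_Ico (by omega) le_rfl)
    fun j _ _ => by linarith [one_le_chainWeight j]

/-- The virial sum, which makes the dissipation of the energy strict. -/
def chainVirial (r : ℕ) (x y : ℕ → ℝ) : ℝ :=
  ∑ k ∈ Finset.range r, chainTail r (k + 1) * (x (k + 1) * y (k + 2))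

lemma abs_chainVirial_le (r : ℕ) (x : ℕ → ℝ) :
    |chainVirial r x x| ≤ chainTail r 1 * ∑ k ∈ Finset.range (r + 1), x (k + 1) ^ 2 := by
  have h1 : ∑ k ∈ Finset.range r, x (k + 1) ^ 2 ≤ ∑ k ∈ Finset.range (r + 1), x (k + 1) ^ 2 := by
    rw [Finset.sum_range_succ]; linarith [sq_nonneg (x (r + 1))]
  have h2 : ∑ k ∈ Finset.range r, x (k + 2) ^ 2 ≤ ∑ k ∈ Finset.range (r + 1), x (k + 1) ^ 2 := by
    rw [Finset.sum_range_succ']; linarith [sq_nonneg (x (0 + 1))]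
  calc |chainVirial r x x| ≤ ∑ k ∈ Finset.range r, chainTail r 1 *
        ((x (k + 1) ^ 2 + x (k + 2) ^ 2) / 2) := by
        refine (Finset.abs_sum_le_sum_abs _ _).trans (Finset.sum_le_sum fun k _ => ?_)
        rw [abs_mul, abs_of_nonneg (chainTail_nonneg _ _)]
        refine mul_le_mul (chainTail_le (by omega)) ?_ (abs_nonneg _) (chainTail_nonneg _ _)
        rw [abs_le]
        constructor <;> nlinarith [sq_nonneg (x (k + 1) + x (k + 2)),
          sq_nonneg (x (k + 1) - x (k + 2))]
    _ ≤ _ := by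
        rw [← Finset.mul_sum, ← Finset.sum_div, Finset.sum_add_distrib]
        exact mul_le_mul_of_nonneg_left (by linarith) (chainTail_nonneg _ _)

/-- Free part of the derivative of the virial sum. -/
lemma chainVirial_free {r : ℕ} (x : ℕ → ℝ) (h0 : x 0 = 0) (hr : x (r + 2) = 0) :
    1 / 2 * ∑ k ∈ Finset.range r, x (k + 2) ^ 2
        - (chainTail r 1 + chainWeight 1) * x 1 ^ 2 ≤
      ∑ k ∈ Finset.range r, chainTail r (k + 1) *
        ((x (k + 2) - x k) * x (k + 2) + x (k + 1) * (x (k + 3) - x (k + 1))) := by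
  have e : ∑ k ∈ Finset.range r, chainTail r (k + 1) *
        ((x (k + 2) - x k) * x (k + 2) + x (k + 1) * (x (k + 3) - x (k + 1)))
      = ∑ k ∈ Finset.range r, chainWeight (k + 2) * x (k + 2) ^ 2 - chainTail r 1 * x 1 ^ 2
        + ∑ k ∈ Finset.range r, chainWeight (k + 2) * (x (k + 1) * x (k + 3)) := by
    -- The summand is an increment of `x (k+1)² + x k * x (k+2)`, so the sum can be integrated by
    -- parts; the upper boundary term vanishes with the tail.
    have e1 := sum_by_parts (chainTail r) (fun k => x (k + 1) ^ 2 + x k * x (k + 2)) r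
    rw [chainTail_last] at e1
    calc _ = _ := Finset.sum_congr rfl fun k _ => by ring
      _ = _ := e1
      _ = ∑ k ∈ Finset.range r, (chainWeight (k + 2) * x (k + 2) ^ 2
            + chainWeight (k + 2) * (x (k + 1) * x (k + 3))) - chainTail r 1 * x 1 ^ 2 := by
          rw [h0, Finset.sum_congr rfl fun k hk => by
            rw [chainTail_sub (Finset.mem_range.1 hk), mul_add]]
          ring_nf
      _ = _ := by rw [Finset.sum_add_distrib]; ring
  -- Each of the two quarter sums is dominated by the diagonal sum, after a shift of index and up to
  -- a term at site `1` (`c1`, `c2`). Half of the diagonal survives.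
  have c : -∑ k ∈ Finset.range r, chainWeight (k + 2) * (x (k + 1) * x (k + 3))
      ≤ (∑ k ∈ Finset.range r, chainWeight (k + 1) * x (k + 1) ^ 2
        + ∑ k ∈ Finset.range r, chainWeight (k + 3) * x (k + 3) ^ 2) / 4 := by
    rw [← Finset.sum_neg_distrib, ← Finset.sum_add_distrib, Finset.sum_div]
    exact Finset.sum_le_sum fun k _ => chainWeight_cross (k + 1) _ _
  have c1 : ∑ k ∈ Finset.range r, chainWeight (k + 1) * x (k + 1) ^ 2
      ≤ chainWeight 1 * x 1 ^ 2 + ∑ k ∈ Finset.range r, chainWeight (k + 2) * x (k + 2) ^ 2 := by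
    have := Finset.sum_range_succ (fun k => chainWeight (k + 1) * x (k + 1) ^ 2) r
    rw [Finset.sum_range_succ'] at this
    have h3 : 0 ≤ chainWeight (r + 1) * x (r + 1) ^ 2 :=
      mul_nonneg (by linarith [one_le_chainWeight (r + 1)]) (sq_nonneg _)
    simp only [zero_add] at this
    linarith
  have c2 : ∑ k ∈ Finset.range r, chainWeight (k + 3) * x (k + 3) ^ 2
      ≤ ∑ k ∈ Finset.range r, chainWeight (k + 2) * x (k + 2) ^ 2 := by
    have := Finset.sum_range_succ (fun k => chainWeight (k + 2) * x (k + 2) ^ 2) r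
    rw [Finset.sum_range_succ', hr] at this
    have h3 : 0 ≤ chainWeight 2 * x 2 ^ 2 :=
      mul_nonneg (by linarith [one_le_chainWeight 2]) (sq_nonneg _)
    simp only [zero_add] at this
    linarith
  have c3 : ∑ k ∈ Finset.range r, x (k + 2) ^ 2
      ≤ ∑ k ∈ Finset.range r, chainWeight (k + 2) * x (k + 2) ^ 2 :=
    Finset.sum_le_sum fun k _ =>
      le_mul_of_one_le_left (sq_nonneg _) (one_le_chainWeight _)
  have h1 : 0 ≤ chainWeight 1 * x 1 ^ 2 :=
    mul_nonneg (by linarith [one_le_chainWeight 1]) (sq_nonneg _)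
  rw [e]
  linarith
/-- Velocity field of the damped and forced chain. -/
def chainField (r : ℕ) (w a b : ℝ) (x : ℕ → ℝ) (fl fr : ℝ) : ℕ → ℝ
  | 0 => 0
  | k + 1 => w * (x (k + 2) - x k) + (if k = 0 then fl - a * x 1 else 0)
      + (if k = r then fr - b * x (r + 1) else 0)

/-- The coupling is skew-symmetric, so its work telescopes and only the two ends exchange energy. -/
lemma chainField_energy (r : ℕ) (w a b : ℝ) (x : ℕ → ℝ) (fl fr : ℝ)
    (h0 : x 0 = 0) (hr : x (r + 2) = 0) :
    ∑ k ∈ Finset.range (r + 1), x (k + 1) * chainField r w a b x fl fr (k + 1)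
      = x 1 * (fl - a * x 1) + x (r + 1) * (fr - b * x (r + 1)) := by
  have e := Finset.sum_range_sub (fun k => w * (x k * x (k + 1))) (r + 1)
  rw [h0, hr, mul_zero, zero_mul, sub_self] at e
  have e1 : ∀ k ∈ Finset.range (r + 1), x (k + 1) * chainField r w a b x fl fr (k + 1)
      = (w * (x (k + 1) * x (k + 1 + 1)) - w * (x k * x (k + 1)))
        + ((if k = 0 then x 1 * (fl - a * x 1) else 0)
        + (if k = r then x (r + 1) * (fr - b * x (r + 1)) else 0)) := by
    intro k _
    simp only [chainField]
    split_ifs <;> subst_vars <;> ring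
  rw [Finset.sum_congr rfl e1, Finset.sum_add_distrib, e, Finset.sum_add_distrib,
    Finset.sum_ite_eq', Finset.sum_ite_eq']
  simp

lemma chainField_virial {r : ℕ} (hr2 : 2 ≤ r) (w a b : ℝ) (x : ℕ → ℝ) (fl fr : ℝ) :
    chainVirial r (chainField r w a b x fl fr) x + chainVirial r x (chainField r w a b x fl fr)
      = w * ∑ k ∈ Finset.range r, chainTail r (k + 1) *
        ((x (k + 2) - x k) * x (k + 2) + x (k + 1) * (x (k + 3) - x (k + 1)))
        + chainTail r 1 * (x 2 * (fl - a * x 1))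
        + chainTail r r * (x r * (fr - b * x (r + 1))) := by
  obtain ⟨q, rfl⟩ : ∃ q, r = q + 1 := ⟨r - 1, by omega⟩
  unfold chainVirial
  rw [← Finset.sum_add_distrib, Finset.mul_sum]
  have e1 : ∀ k ∈ Finset.range (q + 1),
      chainTail (q + 1) (k + 1) * (chainField (q + 1) w a b x fl fr (k + 1) * x (k + 2))
        + chainTail (q + 1) (k + 1) * (x (k + 1) * chainField (q + 1) w a b x fl fr (k + 2))
      = w * (chainTail (q + 1) (k + 1) *
          ((x (k + 2) - x k) * x (k + 2) + x (k + 1) * (x (k + 3) - x (k + 1))))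
        + ((if k = 0 then chainTail (q + 1) 1 * (x 2 * (fl - a * x 1)) else 0)
        + (if k = q then chainTail (q + 1) (q + 1) * (x (q + 1) * (fr - b * x (q + 1 + 1)))
            else 0)) := by
    intro k hk
    have hk' := Finset.mem_range.1 hk
    have n1 : ¬ k = q + 1 := by omega
    simp only [chainField, n1, if_false, Nat.add_right_cancel_iff, Nat.succ_ne_zero]
    split_ifs <;> subst_vars <;> ring
  rw [Finset.sum_congr rfl e1, Finset.sum_add_distrib, Finset.sum_add_distrib,
    Finset.sum_ite_eq', Finset.sum_ite_eq']
  simp [add_assoc]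

/-- The energy dissipates only through the two end velocities; the virial derivative controls all
remaining coordinates. Young's inequality spends `w/8` of them at each end, leaving `w/2 - 2 (w/8) =
w/4`. -/
lemma chainVirial_lower {r : ℕ} (hr2 : 2 ≤ r) {w : ℝ} (a b : ℝ) (hw : 0 < w) :
    ∃ K > 0, ∀ (x : ℕ → ℝ) (fl fr : ℝ), x 0 = 0 → x (r + 2) = 0 →
      w / 4 * ∑ k ∈ Finset.range r, x (k + 2) ^ 2
          - K * (x 1 ^ 2 + x (r + 1) ^ 2 + fl ^ 2 + fr ^ 2)
        ≤ chainVirial r (chainField r w a b x fl fr) x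
          + chainVirial r x (chainField r w a b x fl fr) := by
  set e := chainTail r 1
  have he : 0 ≤ e := chainTail_nonneg _ _
  have hP : 0 ≤ e + chainWeight 1 := by linarith [one_le_chainWeight 1]
  -- The first term is the loss at site `1` in `chainVirial_free`, the second comes from Young's
  -- inequality at the two ends, and `1` only ensures positivity.
  refine ⟨w * (e + chainWeight 1) + 4 * e ^ 2 * (a ^ 2 + b ^ 2 + 1) / w + 1, by positivity,
    fun x fl fr h0 hr => ?_⟩
  have hf := mul_le_mul_of_nonneg_left (chainVirial_free x h0 hr) hw.le
  rw [chainField_virial hr2]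
  have young : ∀ e' u g : ℝ, 0 ≤ e' → e' ≤ e →
      -(w / 8 * u ^ 2 + 2 * e ^ 2 / w * g ^ 2) ≤ e' * (u * g) := by
    intro e' u g h1 h2
    have h3 : 0 ≤ (w / 4 * u + e' * g) ^ 2 * (2 / w) := by positivity
    have h4 : (w / 4 * u + e' * g) ^ 2 * (2 / w)
        = w / 8 * u ^ 2 + e' * (u * g) + 2 * e' ^ 2 / w * g ^ 2 := by field_simp; ring
    have h5 : 2 * e' ^ 2 / w * g ^ 2 ≤ 2 * e ^ 2 / w * g ^ 2 := by gcongr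
    linarith
  have y1 := young e (x 2) (fl - a * x 1) he le_rfl
  have y2 := young (chainTail r r) (x r) (fr - b * x (r + 1)) (chainTail_nonneg _ _)
    (chainTail_le (by omega))
  have s1 : x 2 ^ 2 ≤ ∑ k ∈ Finset.range r, x (k + 2) ^ 2 :=
    Finset.single_le_sum (f := fun k => x (k + 2) ^ 2) (fun k _ => sq_nonneg _)
      (Finset.mem_range.2 (by omega : 0 < r))
  have s2 : x r ^ 2 ≤ ∑ k ∈ Finset.range r, x (k + 2) ^ 2 := by
    have := Finset.single_le_sum (f := fun k => x (k + 2) ^ 2) (fun k _ => sq_nonneg _)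
      (Finset.mem_range.2 (by omega : r - 2 < r))
    simpa [Nat.sub_add_cancel hr2] using this
  have sq : ∀ f c v : ℝ, (f - c * v) ^ 2 ≤ 2 * f ^ 2 + 2 * c ^ 2 * v ^ 2 := by
    intro f c v; nlinarith [sq_nonneg (f + c * v)]
  have q : 0 ≤ 2 * e ^ 2 / w := by positivity
  have z1 := mul_le_mul_of_nonneg_left (sq fl a (x 1)) q
  have z2 := mul_le_mul_of_nonneg_left (sq fr b (x (r + 1))) q
  have w1 := mul_le_mul_of_nonneg_left s1 (by linarith : 0 ≤ w / 8)
  have w2 := mul_le_mul_of_nonneg_left s2 (by linarith : 0 ≤ w / 8)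
  have m : 2 * e ^ 2 / w * (2 * fl ^ 2 + 2 * a ^ 2 * x 1 ^ 2)
      + 2 * e ^ 2 / w * (2 * fr ^ 2 + 2 * b ^ 2 * x (r + 1) ^ 2)
      + w * (e + chainWeight 1) * x 1 ^ 2
      ≤ (w * (e + chainWeight 1) + 4 * e ^ 2 * (a ^ 2 + b ^ 2 + 1) / w + 1)
        * (x 1 ^ 2 + x (r + 1) ^ 2 + fl ^ 2 + fr ^ 2) := by
    have e4 : 4 * e ^ 2 * (a ^ 2 + b ^ 2 + 1) / w = 2 * (2 * e ^ 2 / w) * (a ^ 2 + b ^ 2 + 1) := by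
      ring
    rw [e4]
    have : 0 ≤ w * (e + chainWeight 1) * (x (r + 1) ^ 2 + fl ^ 2 + fr ^ 2)
        + 2 * (2 * e ^ 2 / w) * (a ^ 2 * (x (r + 1) ^ 2 + fl ^ 2 + fr ^ 2)
          + b ^ 2 * (x 1 ^ 2 + fl ^ 2 + fr ^ 2) + x 1 ^ 2 + x (r + 1) ^ 2)
        + (x 1 ^ 2 + x (r + 1) ^ 2 + fl ^ 2 + fr ^ 2) := by positivity
    linarith
  linarith

/-- A strict Lyapunov function of the damped chain. -/
lemma exists_chain_lyapunov {r : ℕ} (hr2 : 2 ≤ r) {w a b : ℝ} (hw : 0 < w) (ha : 0 < a)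
    (hb : 0 < b) :
    ∃ ε > 0, ∃ c > 0, ∃ K > 0, ∀ (x : ℕ → ℝ) (fl fr : ℝ), x 0 = 0 → x (r + 2) = 0 →
      1 / 4 * ∑ k ∈ Finset.range (r + 1), x (k + 1) ^ 2
        ≤ 1 / 2 * ∑ k ∈ Finset.range (r + 1), x (k + 1) ^ 2 - ε * chainVirial r x x ∧
      1 / 2 * ∑ k ∈ Finset.range (r + 1), x (k + 1) ^ 2 - ε * chainVirial r x x
        ≤ ∑ k ∈ Finset.range (r + 1), x (k + 1) ^ 2 ∧
      ∑ k ∈ Finset.range (r + 1), x (k + 1) * chainField r w a b x fl fr (k + 1)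
          - ε * (chainVirial r (chainField r w a b x fl fr) x
            + chainVirial r x (chainField r w a b x fl fr))
        ≤ -c * (1 / 2 * ∑ k ∈ Finset.range (r + 1), x (k + 1) ^ 2 - ε * chainVirial r x x)
          + K * (fl ^ 2 + fr ^ 2) := by
  obtain ⟨K₁, hK₁, hV⟩ := chainVirial_lower hr2 a b hw
  set e := chainTail r 1
  have he : 0 ≤ e := chainTail_nonneg _ _
  -- The first two bounds let the end dissipation, half of which remains after Young's inequality
  -- for the forces, pay for the boundary loss of the virial. The third keeps the Lyapunov function
  -- comparable with the energy.
  obtain ⟨ε, hε, hεa, hεb, hεe⟩ : ∃ ε > 0, ε * K₁ ≤ a / 4 ∧ ε * K₁ ≤ b / 4 ∧ ε * e ≤ 1 / 4 := by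
    refine ⟨min (min (a / 4 / K₁) (b / 4 / K₁)) (1 / 4 / (e + 1)), by positivity, ?_, ?_, ?_⟩
    · rw [← le_div_iff₀ hK₁]; exact (min_le_left _ _).trans (min_le_left _ _)
    · rw [← le_div_iff₀ hK₁]; exact (min_le_left _ _).trans (min_le_right _ _)
    · have h1 : min (min (a / 4 / K₁) (b / 4 / K₁)) (1 / 4 / (e + 1)) * (e + 1) ≤ 1 / 4 := by
        rw [← le_div_iff₀ (by linarith)]; exact min_le_right _ _
      have h2 : 0 ≤ min (min (a / 4 / K₁) (b / 4 / K₁)) (1 / 4 / (e + 1)) := by positivity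
      linarith
  -- The rate is the smaller coefficient of what is left: `a/4` on `x 1 ^ 2` from damping and `ε
  -- w/4` on the other squares from the virial.
  refine ⟨ε, hε, min (a / 4) (ε * w / 4), by positivity, ε * K₁ + 1 / (2 * a) + 1 / (2 * b),
    by positivity, fun x fl fr h0 hr => ?_⟩
  have hS : 0 ≤ ∑ k ∈ Finset.range (r + 1), x (k + 1) ^ 2 :=
    Finset.sum_nonneg fun k _ => sq_nonneg _
  have hSs : ∑ k ∈ Finset.range (r + 1), x (k + 1) ^ 2
      = ∑ k ∈ Finset.range r, x (k + 2) ^ 2 + x 1 ^ 2 := Finset.sum_range_succ' _ _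
  have hS2 : 0 ≤ ∑ k ∈ Finset.range r, x (k + 2) ^ 2 := Finset.sum_nonneg fun k _ => sq_nonneg _
  have hA := abs_le.1 (abs_chainVirial_le r x)
  have hV' := mul_le_mul_of_nonneg_left (hV x fl fr h0 hr) hε.le
  rw [chainField_energy r w a b x fl fr h0 hr]
  set S := ∑ k ∈ Finset.range (r + 1), x (k + 1) ^ 2
  set S2 := ∑ k ∈ Finset.range r, x (k + 2) ^ 2
  have hv1 := mul_le_mul_of_nonneg_left hA.1 hε.le
  have hv2 := mul_le_mul_of_nonneg_left hA.2 hε.le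
  have hve := mul_le_mul_of_nonneg_right hεe hS
  have young : ∀ c : ℝ, 0 < c → ∀ u f : ℝ, u * (f - c * u) ≤ -(c / 2) * u ^ 2 + 1 / (2 * c) * f ^ 2 := by
    intro c hc u f
    have h3 : 0 ≤ (c * u - f) ^ 2 * (1 / (2 * c)) := by positivity
    have h4 : (c * u - f) ^ 2 * (1 / (2 * c))
        = c / 2 * u ^ 2 - u * f + 1 / (2 * c) * f ^ 2 := by field_simp; ring
    linarith
  have y1 := young a ha (x 1) fl
  have y2 := young b hb (x (r + 1)) fr
  have k1 := mul_le_mul_of_nonneg_right hεa (sq_nonneg (x 1))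
  have k2 := mul_le_mul_of_nonneg_right hεb (sq_nonneg (x (r + 1)))
  have b1 : 0 ≤ b / 4 * x (r + 1) ^ 2 := by positivity
  refine ⟨by linarith, by linarith, ?_⟩
  have c1 : min (a / 4) (ε * w / 4) * (1 / 2 * S - ε * chainVirial r x x)
      ≤ a / 4 * x 1 ^ 2 + ε * w / 4 * S2 := by
    have m0 : 0 ≤ min (a / 4) (ε * w / 4) := by positivity
    calc _ ≤ min (a / 4) (ε * w / 4) * (S2 + x 1 ^ 2) :=
          mul_le_mul_of_nonneg_left (by linarith) m0
      _ ≤ _ := by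
          rw [mul_add, add_comm]
          exact add_le_add (mul_le_mul_of_nonneg_right (min_le_left _ _) (sq_nonneg _))
            (mul_le_mul_of_nonneg_right (min_le_right _ _) hS2)
  have f1 : 0 ≤ 1 / (2 * a) * fr ^ 2 := by positivity
  have f2 : 0 ≤ 1 / (2 * b) * fl ^ 2 := by positivity
  linarith

/-- Comparison for a dissipative scalar differential inequality. -/
lemma le_of_deriv_le_neg_mul {L L' : ℝ → ℝ} {c B t₀ : ℝ} (hc : 0 < c) (hB0 : 0 ≤ B)
    (hL : ∀ t ≥ t₀, HasDerivAt L (L' t) t) (h : ∀ t ≥ t₀, L' t ≤ -c * L t + B) {t : ℝ}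
    (ht : t₀ ≤ t) : L t ≤ L t₀ * Real.exp (-c * (t - t₀)) + B / c := by
  have hd : ∀ s ≥ t₀, HasDerivAt (fun s => (L s - B / c) * Real.exp (c * (s - t₀)))
      ((L' s + c * L s - B) * Real.exp (c * (s - t₀))) s := by
    intro s hs
    have h1 : HasDerivAt (fun s => Real.exp (c * (s - t₀))) (Real.exp (c * (s - t₀)) * c) s := by
      have := (((hasDerivAt_id s).sub_const t₀).const_mul c).exp
      simpa using this
    refine (((hL s hs).sub_const (B / c)).mul h1).congr_deriv ?_
    field_simp
    ring
  have anti : AntitoneOn (fun s => (L s - B / c) * Real.exp (c * (s - t₀))) (Set.Ici t₀) := by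
    refine antitoneOn_of_deriv_nonpos (convex_Ici _)
      (fun s hs => (hd s hs).continuousAt.continuousWithinAt)
      (fun s hs => (hd s (interior_subset hs)).differentiableAt.differentiableWithinAt)
      fun s hs => ?_
    rw [(hd s (interior_subset hs)).deriv]
    exact mul_nonpos_of_nonpos_of_nonneg (by linarith [h s (interior_subset hs)])
      (Real.exp_pos _).le
  have := anti (Set.mem_Ici.2 le_rfl) ht ht
  simp only [sub_self, mul_zero, Real.exp_zero, mul_one] at this
  have hB : 0 < Real.exp (-c * (t - t₀)) := Real.exp_pos _
  have e : Real.exp (c * (t - t₀)) * Real.exp (-c * (t - t₀)) = 1 := by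
    rw [← Real.exp_add]; simp
  have h2 := mul_le_mul_of_nonneg_right this hB.le
  rw [mul_assoc, e, mul_one] at h2
  nlinarith [div_nonneg hB0 hc.le]

/-- Exponential stability of the damped chain, with the response to bounded boundary forces. -/
theorem exists_chain_stability {r : ℕ} (hr2 : 2 ≤ r) {w a b : ℝ} (hw : 0 < w) (ha : 0 < a)
    (hb : 0 < b) :
    ∃ C > 0, ∃ c > 0, ∀ (z : ℕ → ℝ → ℝ) (fl fr : ℝ → ℝ) (A B t₀ : ℝ), 0 < t₀ → 0 ≤ B →
      ChainODE r w a b z fl fr → (∀ k ≤ r, z (k + 1) t₀ ^ 2 ≤ A) →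
      (∀ t ≥ t₀, fl t ^ 2 ≤ B) → (∀ t ≥ t₀, fr t ^ 2 ≤ B) →
      ∀ t ≥ t₀, ∀ k ≤ r, z (k + 1) t ^ 2 ≤ C * (A * Real.exp (-c * (t - t₀)) + B) := by
  obtain ⟨ε, hε, c, hc, K, hK, H⟩ := exists_chain_lyapunov hr2 hw ha hb
  -- The factor `4` comes from the lower bound `S/4` on the Lyapunov function, `r + 1` from summing
  -- the initial bounds, and `8 K / c` from two forces of size `B`. Neither constant depends on the
  -- solution, so estimates can be uniform in an observation time.
  refine ⟨4 * (r + 1) + 8 * K / c, by positivity, c, hc,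
    fun z fl fr A B t₀ ht₀ hB hz hA hfl hfr t ht k hk => ?_⟩
  have hA0 : 0 ≤ A := (sq_nonneg _).trans (hA 0 (Nat.zero_le _))
  set L : ℝ → ℝ := fun t => 1 / 2 * ∑ k ∈ Finset.range (r + 1), z (k + 1) t ^ 2
    - ε * chainVirial r (fun k => z k t) (fun k => z k t) with hL
  set y : ℝ → ℕ → ℝ := fun t => chainField r w a b (fun k => z k t) (fl t) (fr t) with hy
  have hzd : ∀ k ≤ r, ∀ t, 0 < t → HasDerivAt (z (k + 1)) (y t (k + 1)) t := hz.deriv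
  have hLd : ∀ t ≥ t₀, HasDerivAt L (∑ k ∈ Finset.range (r + 1), z (k + 1) t * y t (k + 1)
      - ε * (chainVirial r (y t) (fun k => z k t) + chainVirial r (fun k => z k t) (y t))) t := by
    intro t ht
    have ht0 : 0 < t := ht₀.trans_le ht
    have h1 : HasDerivAt (fun t => ∑ k ∈ Finset.range (r + 1), z (k + 1) t ^ 2)
        (∑ k ∈ Finset.range (r + 1), 2 * (z (k + 1) t * y t (k + 1))) t := by
      refine HasDerivAt.fun_sum fun k hk => ?_
      have := (hzd k (by have := Finset.mem_range.1 hk; omega) t ht0).pow 2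
      refine this.congr_deriv ?_
      norm_num
      ring
    have h2 : HasDerivAt (fun t => chainVirial r (fun k => z k t) (fun k => z k t))
        (chainVirial r (y t) (fun k => z k t) + chainVirial r (fun k => z k t) (y t)) t := by
      unfold chainVirial
      rw [← Finset.sum_add_distrib]
      refine HasDerivAt.fun_sum fun k hk => ?_
      have hk' := Finset.mem_range.1 hk
      have := ((hzd k (by omega) t ht0).mul (hzd (k + 1) (by omega) t ht0)).const_mul
        (chainTail r (k + 1))
      exact this.congr_deriv (by ring)
    refine ((h1.const_mul (1 / 2)).sub (h2.const_mul ε)).congr_deriv ?_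
    rw [← Finset.mul_sum]
    ring
  have hdec := le_of_deriv_le_neg_mul (B := K * (B + B)) hc (by positivity) hLd
    (fun t ht => ((H (fun k => z k t) (fl t) (fr t) (hz.left t) (hz.right t)).2.2).trans
      (by have := hfl t ht; have := hfr t ht; gcongr)) ht
  have h0 := (H (fun k => z k t₀) 0 0 (hz.left t₀) (hz.right t₀)).2.1
  have h1 := (H (fun k => z k t) 0 0 (hz.left t) (hz.right t)).1
  have h2 : ∑ k ∈ Finset.range (r + 1), z (k + 1) t₀ ^ 2 ≤ (r + 1) * A := by
    have := Finset.sum_le_card_nsmul (Finset.range (r + 1)) (fun k => z (k + 1) t₀ ^ 2) A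
      fun k hk => hA k (by have := Finset.mem_range.1 hk; omega)
    simpa using this
  have h3 : z (k + 1) t ^ 2 ≤ ∑ k ∈ Finset.range (r + 1), z (k + 1) t ^ 2 :=
    Finset.single_le_sum (f := fun k => z (k + 1) t ^ 2) (fun k _ => sq_nonneg _)
      (Finset.mem_range.2 (by omega))
  have hE : 0 < Real.exp (-c * (t - t₀)) := Real.exp_pos _
  have h4 : L t₀ * Real.exp (-c * (t - t₀)) ≤ (r + 1) * A * Real.exp (-c * (t - t₀)) :=
    mul_le_mul_of_nonneg_right (h0.trans h2) hE.le
  have h5 : 0 ≤ 8 * K / c * (A * Real.exp (-c * (t - t₀))) + 4 * (r + 1) * B := by positivity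
  calc z (k + 1) t ^ 2 ≤ 4 * L t := by simp only [hL]; linarith
    _ ≤ 4 * ((r + 1) * A * Real.exp (-c * (t - t₀)) + K * (B + B) / c) := by linarith
    _ = 4 * (r + 1) * (A * Real.exp (-c * (t - t₀))) + 8 * K / c * B := by ring
    _ ≤ _ := by linarith

/-! ### States: Cauchy-Schwarz and mean-square derivatives -/

namespace StarState

variable {𝒜 : Type u} [Ring 𝒜] [StarRing 𝒜] [Algebra ℂ 𝒜] (φ : StarState 𝒜)

/-- The real part of the sesquilinear form of a state. -/
def inner (a b : 𝒜) : ℝ := (φ.toFun (star a * b)).re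

lemma inner_add_left (a b c : 𝒜) : φ.inner (a + b) c = φ.inner a c + φ.inner b c := by
  simp [inner, add_mul]

lemma inner_sub_left (a b c : 𝒜) : φ.inner (a - b) c = φ.inner a c - φ.inner b c := by
  simp [inner, sub_mul]

lemma inner_zero_left (c : 𝒜) : φ.inner 0 c = 0 := by simp [inner]

lemma inner_self_nonneg (a : 𝒜) : 0 ≤ φ.inner a a := (φ.nonneg a).1

variable [StarModule ℂ 𝒜]

/-- Hermiticity is not an axiom of `StarState`: it follows by polarization, from the reality of the
state on `star b * b` for `b = a + 1` and `b = a + i`. -/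
lemma map_star (a : 𝒜) : φ.toFun (star a) = conj (φ.toFun a) := by
  have h1 := (φ.nonneg (a + 1)).2
  have h2 := (φ.nonneg (a + Complex.I • (1 : 𝒜))).2
  have h0 := (φ.nonneg a).2
  have e1 : star (a + 1) * (a + 1) = star a * a + star a + a + 1 := by
    rw [star_add, star_one]; noncomm_ring
  have e2 : star (a + Complex.I • (1 : 𝒜)) * (a + Complex.I • (1 : 𝒜))
      = star a * a + Complex.I • star a - Complex.I • a + 1 := by
    rw [star_add, star_smul, star_one, RCLike.star_def, Complex.conj_I]
    simp only [add_mul, mul_add, smul_mul_assoc, mul_smul_comm, one_mul, mul_one]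
    rw [smul_add, smul_smul, mul_neg, Complex.I_mul_I]
    module
  rw [e1] at h1
  rw [e2] at h2
  simp [φ.map_one, h0] at h1 h2
  apply Complex.ext
  · simp; linarith
  · simp; linarith

lemma inner_comm (a b : 𝒜) : φ.inner a b = φ.inner b a := by
  unfold inner
  rw [← star_star (star a * b), star_mul, star_star, map_star]
  simp

lemma inner_smul_left (x : ℝ) (a c : 𝒜) : φ.inner ((x : ℂ) • a) c = x * φ.inner a c := by
  simp [inner, star_smul]

lemma inner_sq_le (a b : 𝒜) : φ.inner a b ^ 2 ≤ φ.inner a a * φ.inner b b := by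
  have h : ∀ x : ℝ, 0 ≤ φ.inner a a * (x * x) + 2 * φ.inner a b * x + φ.inner b b := by
    intro x
    have := φ.inner_self_nonneg ((x : ℂ) • a + b)
    rw [inner_add_left, inner_smul_left, inner_comm _ a, inner_comm _ b, inner_add_left,
      inner_add_left, inner_smul_left, inner_smul_left, inner_comm _ b a] at this
    linarith
  have := discrim_le_zero h
  unfold discrim at this
  linarith

/-- The two orderings of a product of self-adjoint elements have conjugate expectations, so
symmetrizing takes the real part. -/
lemma sym_eq_inner {a b : 𝒜} (ha : IsSelfAdjoint a) (hb : IsSelfAdjoint b) :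
    φ.sym a b = φ.inner a b := by
  have h : φ.toFun (b * a) = conj (φ.toFun (a * b)) := by
    rw [← map_star, star_mul, ha.star_eq, hb.star_eq]
  rw [sym, inner, ha.star_eq, map_add, h, Complex.add_conj]
  push_cast
  ring

lemma map_mul_self_eq_inner {a : 𝒜} (ha : IsSelfAdjoint a) :
    φ.toFun (a * a) = φ.inner a a := by
  have := φ.sym_eq_inner ha ha
  rwa [sym, map_add, add_self_div_two] at this

variable {φ} in
-- Cauchy-Schwarz bounds the error of the scalar difference quotient by the mean-square error; this
-- is how operator equations become ordinary differential equations.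
lemma HasMeanSquareDerivAt.hasDerivAt_inner {Y : ℝ → 𝒜} {Z : 𝒜} {t : ℝ}
    (h : φ.HasMeanSquareDerivAt Y Z t) (c : 𝒜) :
    HasDerivAt (fun t => φ.inner (Y t) c) (φ.inner Z c) t := by
  rw [hasDerivAt_iff_tendsto_slope_zero, ← tendsto_sub_nhds_zero_iff]
  have h1 := (Tendsto.mul_const (φ.inner c c) h).sqrt
  rw [zero_mul, Real.sqrt_zero] at h1
  refine squeeze_zero_norm (fun x => ?_) h1
  rw [Real.norm_eq_abs]
  refine Real.abs_le_sqrt ?_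
  have e : x⁻¹ • (φ.inner (Y (t + x)) c - φ.inner (Y t) c) - φ.inner Z c
      = φ.inner ((x⁻¹ : ℂ) • (Y (t + x) - Y t) - Z) c := by
    have := φ.inner_smul_left x⁻¹ (Y (t + x) - Y t) c
    push_cast at this
    rw [inner_sub_left, this, inner_sub_left, smul_eq_mul]
  rw [e]
  exact φ.inner_sq_le _ _

end StarState

/-! ### Hyperbolic cotangent -/

lemma realCoth_neg (x : ℝ) : realCoth (-x) = -realCoth x := by
  simp [realCoth, div_neg]

lemma measurable_realCoth : Measurable realCoth :=
  Real.continuous_cosh.measurable.div Real.continuous_sinh.measurable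

/-- For `y > 0` the difference equals `y exp (-y) / sinh y`, and `y ≤ sinh y`. -/
lemma mul_realCoth_sub_abs_mem (x : ℝ) :
    x * realCoth x - |x| ∈ Set.Icc 0 (Real.exp (-|x|)) ∨ x = 0 := by
  have pos : ∀ y : ℝ, 0 < y → y * realCoth y - |y| ∈ Set.Icc 0 (Real.exp (-|y|)) := by
    intro y hy
    have hs : 0 < Real.sinh y := Real.sinh_pos_iff.2 hy
    have e : y * realCoth y - |y| = y * Real.exp (-y) / Real.sinh y := by
      rw [realCoth, abs_of_pos hy, ← Real.cosh_sub_sinh]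
      field_simp
    rw [e, abs_of_pos hy]
    refine ⟨by positivity, ?_⟩
    rw [div_le_iff₀ hs, mul_comm]
    exact mul_le_mul_of_nonneg_left (Real.self_le_sinh_iff.2 hy.le) (Real.exp_pos _).le
  rcases lt_trichotomy x 0 with h | h | h
  · left
    have := pos (-x) (by linarith)
    rwa [realCoth_neg, abs_neg, neg_mul_neg] at this
  · exact Or.inr h
  · exact Or.inl (pos x h)

lemma abs_mul_realCoth_le (x : ℝ) : |x * realCoth x| ≤ |x| + 1 := by
  rcases mul_realCoth_sub_abs_mem x with h | h
  · have : Real.exp (-|x|) ≤ 1 := Real.exp_le_one_iff.2 (by simp)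
    rw [abs_le]
    constructor <;> linarith [h.1, h.2, abs_nonneg x]
  · simp [h]

/-- Both products are `|x|` plus an exponentially small error, and `|x|` cancels. This makes the
current finite without a cutoff. -/
lemma abs_mul_realCoth_sub_le {c c' : ℝ} (hc : 0 < c) (hc' : 0 < c') (x : ℝ) :
    |x * (realCoth (c * x) - realCoth (c' * x))|
      ≤ Real.exp (-(c * |x|)) / c + Real.exp (-(c' * |x|)) / c' := by
  have key : ∀ c : ℝ, 0 < c →
      x * realCoth (c * x) - |x| ∈ Set.Icc 0 (Real.exp (-(c * |x|)) / c) ∨ x = 0 := by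
    intro c hc
    rcases mul_realCoth_sub_abs_mem (c * x) with h | h
    · left
      rw [abs_mul, abs_of_pos hc] at h
      have e : x * realCoth (c * x) - |x| = (c * x * realCoth (c * x) - c * |x|) / c := by
        field_simp
      rw [e]
      exact ⟨div_nonneg h.1 hc.le, div_le_div_of_nonneg_right h.2 hc.le⟩
    · exact Or.inr ((mul_eq_zero.1 h).resolve_left hc.ne')
  have p1 : 0 < Real.exp (-(c * |x|)) / c := by positivity
  have p2 : 0 < Real.exp (-(c' * |x|)) / c' := by positivity
  rcases key c hc with h | h
  · rcases key c' hc' with h' | h'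
    · rw [abs_le]
      constructor <;> linarith [h.1, h.2, h'.1, h'.2]
    · simp [h']; positivity
  · simp [h]; positivity

/-! ### Fourier integrals over the spectral window of the noise -/

/-- Fourier integral over the window `[0, Ω]`. -/
def fourierMoment (Ω : ℝ) (f : ℝ → ℂ) (τ : ℝ) : ℂ :=
  ∫ ω in (0 : ℝ)..Ω, f ω * Complex.exp (Complex.I * ω * τ)

section

variable {Ω : ℝ} {f g : ℝ → ℂ}

lemma IntervalIntegrable.mul_expI (hf : IntervalIntegrable f volume 0 Ω) (τ : ℝ) :
    IntervalIntegrable (fun ω : ℝ => f ω * Complex.exp (Complex.I * ω * τ)) volume 0 Ω :=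
  hf.mul_continuousOn (by fun_prop)

lemma norm_expI (ω τ : ℝ) : ‖Complex.exp (Complex.I * ω * τ)‖ = 1 := by
  rw [show Complex.I * ω * τ = ((ω * τ : ℝ) : ℂ) * Complex.I by push_cast; ring,
    Complex.norm_exp_ofReal_mul_I]

lemma fourierMoment_add (hf : IntervalIntegrable f volume 0 Ω)
    (hg : IntervalIntegrable g volume 0 Ω) (τ : ℝ) :
    fourierMoment Ω (fun ω => f ω + g ω) τ = fourierMoment Ω f τ + fourierMoment Ω g τ := by
  unfold fourierMoment
  rw [← intervalIntegral.integral_add (hf.mul_expI τ) (hg.mul_expI τ)]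
  simp only [add_mul]

lemma fourierMoment_sub (hf : IntervalIntegrable f volume 0 Ω)
    (hg : IntervalIntegrable g volume 0 Ω) (τ : ℝ) :
    fourierMoment Ω (fun ω => f ω - g ω) τ = fourierMoment Ω f τ - fourierMoment Ω g τ := by
  unfold fourierMoment
  rw [← intervalIntegral.integral_sub (hf.mul_expI τ) (hg.mul_expI τ)]
  simp only [sub_mul]

lemma fourierMoment_const_mul (c : ℂ) (f : ℝ → ℂ) (τ : ℝ) :
    fourierMoment Ω (fun ω => c * f ω) τ = c * fourierMoment Ω f τ := by
  unfold fourierMoment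
  rw [← intervalIntegral.integral_const_mul]
  simp only [mul_assoc]

lemma fourierMoment_zero (τ : ℝ) : fourierMoment Ω (fun _ => 0) τ = 0 := by
  simp [fourierMoment]

lemma norm_fourierMoment_le (hΩ : 0 < Ω) (f : ℝ → ℂ) (τ : ℝ) :
    ‖fourierMoment Ω f τ‖ ≤ ∫ ω in (0 : ℝ)..Ω, ‖f ω‖ := by
  refine (intervalIntegral.norm_integral_le_integral_norm hΩ.le).trans_eq ?_
  simp [norm_expI]

lemma conj_fourierMoment (f : ℝ → ℂ) (τ : ℝ) :
    conj (fourierMoment Ω f τ) = fourierMoment Ω (fun ω => conj (f ω)) (-τ) := by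
  unfold fourierMoment
  simp only [intervalIntegral.intervalIntegral_eq_integral_uIoc, Complex.real_smul, map_mul,
    Complex.conj_ofReal]
  rw [← integral_conj]
  congr 2
  ext ω
  simp [← Complex.exp_conj]

/-- On the bounded window the factor `ω` preserves integrability, so `‖i ω f‖` dominates the
derivative under the integral. -/
lemma hasDerivAt_fourierMoment (hf : IntervalIntegrable f volume 0 Ω) (τ : ℝ) :
    HasDerivAt (fourierMoment Ω f) (fourierMoment Ω (fun ω => Complex.I * ω * f ω) τ) τ := by
  have hg : IntervalIntegrable (fun ω : ℝ => Complex.I * ω * f ω) volume 0 Ω :=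
    hf.continuousOn_mul (by fun_prop)
  refine (intervalIntegral.hasDerivAt_integral_of_dominated_loc_of_deriv_le (𝕜 := ℝ)
    (F := fun τ ω => f ω * Complex.exp (Complex.I * ω * τ))
    (F' := fun τ ω => Complex.I * ω * f ω * Complex.exp (Complex.I * ω * τ))
    (bound := fun ω => ‖Complex.I * ω * f ω‖) univ_mem (.of_forall fun x => ?_)
    (hf.mul_expI τ) ?_ (.of_forall fun ω _ x _ => ?_) hg.norm
    (.of_forall fun ω _ x _ => ?_)).2
  · exact (intervalIntegrable_iff.1 (hf.mul_expI x)).aestronglyMeasurable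
  · exact (intervalIntegrable_iff.1 (hg.mul_expI τ)).aestronglyMeasurable
  · rw [norm_mul _ (Complex.exp _), norm_expI, mul_one]
  · have h1 : HasDerivAt (fun x : ℝ => Complex.I * ω * (x : ℂ)) (Complex.I * ω) x := by
      simpa using (Complex.ofRealCLM.hasDerivAt (x := x)).const_mul (Complex.I * ω)
    exact ((h1.cexp).const_mul (f ω)).congr_deriv (by ring)

/-- Superpositions of harmonic solutions of the forced chain solve the equations of motion. -/
lemma ChainODE.of_modes {r : ℕ} {w a b : ℝ} {h : ℕ → ℝ → ℂ} {gl gr : ℝ → ℂ}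
    (hh : ∀ k, IntervalIntegrable (h k) volume 0 Ω) (hgl : IntervalIntegrable gl volume 0 Ω)
    (hgr : IntervalIntegrable gr volume 0 Ω) (h0 : ∀ ω, h 0 ω = 0) (hr : ∀ ω, h (r + 2) ω = 0)
    (heq : ∀ k ≤ r, ∀ ω : ℝ, -Complex.I * ω * h (k + 1) ω
      = w * (h (k + 2) ω - h k ω) + (if k = 0 then gl ω - a * h 1 ω else 0)
        + (if k = r then gr ω - b * h (r + 1) ω else 0)) (t' : ℝ) :
    ChainODE r w a b (fun k t => (fourierMoment Ω (h k) (t' - t)).re)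
      (fun t => (fourierMoment Ω gl (t' - t)).re) (fun t => (fourierMoment Ω gr (t' - t)).re) where
  left t := by
    rw [show h 0 = fun _ => 0 from funext h0, fourierMoment_zero, Complex.zero_re]
  right t := by
    rw [show h (r + 2) = fun _ => 0 from funext hr, fourierMoment_zero, Complex.zero_re]
  deriv k hk t _ := by
    have h1 := (hasDerivAt_fourierMoment (hh (k + 1)) (t' - t)).scomp t
      ((hasDerivAt_id t).const_sub t')
    have h2 := Complex.reCLM.hasFDerivAt.comp_hasDerivAt t h1
    refine h2.congr_deriv ?_
    have hL : IntervalIntegrable (fun ω => if k = 0 then gl ω - a * h 1 ω else 0) volume 0 Ω := by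
      split_ifs
      · exact hgl.sub ((hh 1).const_mul _)
      · exact intervalIntegrable_const
    have hR : IntervalIntegrable (fun ω => if k = r then gr ω - b * h (r + 1) ω else 0)
        volume 0 Ω := by
      split_ifs
      · exact hgr.sub ((hh (r + 1)).const_mul _)
      · exact intervalIntegrable_const
    have e : fourierMoment Ω (fun ω => -1 * (Complex.I * ω * h (k + 1) ω)) (t' - t)
        = w * (fourierMoment Ω (h (k + 2)) (t' - t) - fourierMoment Ω (h k) (t' - t))
          + (if k = 0 then fourierMoment Ω gl (t' - t) - a * fourierMoment Ω (h 1) (t' - t) else 0)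
          + (if k = r then fourierMoment Ω gr (t' - t)
              - b * fourierMoment Ω (h (r + 1)) (t' - t) else 0) := by
      rw [show (fun ω : ℝ => -1 * (Complex.I * ω * h (k + 1) ω)) = fun ω =>
        w * (h (k + 2) ω - h k ω) + (if k = 0 then gl ω - a * h 1 ω else 0)
        + (if k = r then gr ω - b * h (r + 1) ω else 0) from funext fun ω => by
          rw [← heq k hk ω]; ring,
        fourierMoment_add ((((hh _).sub (hh _)).const_mul _).add hL) hR,
        fourierMoment_add (((hh _).sub (hh _)).const_mul _) hL, fourierMoment_const_mul,
        fourierMoment_sub (hh _) (hh _)]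
      congr 1
      · congr 1
        split_ifs
        · rw [fourierMoment_sub hgl ((hh 1).const_mul _), fourierMoment_const_mul]
        · exact fourierMoment_zero _
      · split_ifs
        · rw [fourierMoment_sub hgr ((hh _).const_mul _), fourierMoment_const_mul]
        · exact fourierMoment_zero _
    rw [fourierMoment_const_mul] at e
    have e' := congrArg Complex.re e
    simp only [Complex.reCLM_apply, Complex.real_smul]
    push_cast
    rw [e']
    split_ifs <;> simp

end

/-! ### Spectral density of the noise -/

namespace HarmonicChain

variable (p : HarmonicChain)

/-- Spectral density of the noise of a reservoir. -/
def noiseWeight (η T ω : ℝ) : ℝ :=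
  η * p.hbar / Real.pi * (ω * realCoth (p.hbar * ω / (2 * p.kB * T)))

lemma intervalIntegrable_noiseWeight (η : ℝ) {T : ℝ} (hT : 0 < T) (x y : ℝ) :
    IntervalIntegrable (p.noiseWeight η T) volume x y := by
  have hc : 0 < p.hbar / (2 * p.kB * T) := by
    have := p.hbar_pos; have := p.kB_pos; positivity
  set c := p.hbar / (2 * p.kB * T) with hcd
  have e : p.noiseWeight η T
      = fun ω => η * p.hbar / Real.pi * (ω * realCoth (c * ω)) := by
    ext ω
    rw [noiseWeight, hcd]
    congr 3
    ring
  rw [e]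
  refine IntervalIntegrable.const_mul ?_ _
  have hi : IntervalIntegrable (fun ω : ℝ => |ω| + 1 / c) volume x y :=
    Continuous.intervalIntegrable (by fun_prop) _ _
  refine hi.mono_fun ?_ (.of_forall fun ω => ?_)
  · exact (measurable_id.mul (measurable_realCoth.comp (measurable_const_mul c))).aestronglyMeasurable
  · have h := abs_mul_realCoth_le (c * ω)
    have e2 : ω * realCoth (c * ω) = c * ω * realCoth (c * ω) / c := by field_simp
    have h3 : (0 : ℝ) ≤ |ω| + 1 / c := by positivity
    simp only [Real.norm_eq_abs]
    rw [abs_of_nonneg h3, e2, abs_div, abs_of_pos hc, div_le_iff₀ hc]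
    rw [abs_mul c, abs_of_pos hc] at h
    calc _ ≤ _ := h
      _ = _ := by field_simp

lemma intervalIntegrable_noiseWeight_ofReal (η : ℝ) {T : ℝ} (hT : 0 < T) (x y : ℝ) :
    IntervalIntegrable (fun ω => (p.noiseWeight η T ω : ℂ)) volume x y :=
  ⟨(p.intervalIntegrable_noiseWeight η hT x y).1.ofReal,
    (p.intervalIntegrable_noiseWeight η hT x y).2.ofReal⟩

lemma noiseCorrelation_eq {η T : ℝ} (hT : 0 < T) (Ω τ : ℝ) :
    p.noiseCorrelation η T Ω τ
      = (fourierMoment Ω (fun ω => (p.noiseWeight η T ω : ℂ)) τ).re := by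
  have hi : IntervalIntegrable (fun ω => (p.noiseWeight η T ω : ℂ)) volume 0 Ω :=
    p.intervalIntegrable_noiseWeight_ofReal η hT 0 Ω
  have := intervalIntegral.intervalIntegral_re (hi.mul_expI τ)
  simp only [RCLike.re_eq_complex_re] at this
  rw [fourierMoment, ← this, noiseCorrelation, ← intervalIntegral.integral_const_mul]
  congr 1
  ext ω
  rw [Complex.re_ofReal_mul, Complex.exp_re]
  simp [noiseWeight]
  ring

end HarmonicChain

/-! ### Frequency response to unit end forces -/

lemma chainNum_zero (β : ℝ) (s : ℂ) : chainNum 0 β s = 1 := by simp [chainNum]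

lemma chainNum_one (β : ℝ) (s : ℂ) : chainNum 1 β s = -(2 * Complex.I * s) + 2 * β := by
  simp [chainNum, chainPoly_add_two]

lemma chainNum_add_two (k : ℕ) (β : ℝ) (s : ℂ) :
    chainNum (k + 2) β s = chainNum k β s - 2 * Complex.I * s * chainNum (k + 1) β s := by
  simp only [chainNum]
  rw [chainPoly_add_two s (k + 1), chainPoly_add_two s k]
  ring

lemma chainDen_eq_chainNum (r : ℕ) (α β : ℝ) (s : ℂ) :
    chainDen r α β s = chainNum (r + 1) α s + 2 * β * chainNum r α s := by
  unfold chainDen chainNum; ring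

namespace HarmonicChain

variable (p : HarmonicChain)

/-- Response of the chain to a unit force on its last mass. -/
def respR : ℕ → ℝ → ℂ
  | 0, _ => 0
  | k + 1, ω => if k ≤ p.rank then
      chainNum k p.αL (ω / (2 * p.ω₀) : ℝ) / (p.m * p.ω₀ * p.den ω) else 0

/-- Response of the chain to a unit force on its first mass. -/
def respL : ℕ → ℝ → ℂ
  | 0, _ => 0
  | k + 1, ω => if k ≤ p.rank then
      (-1) ^ k * chainNum (p.rank - k) p.αR (ω / (2 * p.ω₀) : ℝ) / (p.m * p.ω₀ * p.den ω) else 0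

lemma prefactor_ne_zero (ω : ℝ) : (p.m : ℂ) * p.ω₀ * p.den ω ≠ 0 := by
  have h1 : (p.m : ℂ) ≠ 0 := by exact_mod_cast p.m_pos.ne'
  have h2 : (p.ω₀ : ℂ) ≠ 0 := by exact_mod_cast p.ω₀_pos.ne'
  exact mul_ne_zero (mul_ne_zero h1 h2) (p.den_ne_zero ω)

lemma continuous_respR (k : ℕ) : Continuous (p.respR k) := by
  match k with
  | 0 => exact continuous_const
  | k + 1 =>
    have e : p.respR (k + 1) = fun ω : ℝ => if k ≤ p.rank then
      chainNum k p.αL (ω / (2 * p.ω₀) : ℝ) / (p.m * p.ω₀ * p.den ω) else 0 := rfl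
    rw [e]
    by_cases h : k ≤ p.rank
    · simp only [h, if_true]
      refine Continuous.div ((continuous_chainNum _ _).comp (by fun_prop)) ?_ p.prefactor_ne_zero
      exact continuous_const.mul p.continuous_den
    · simp only [h, if_false]
      exact continuous_const

lemma continuous_respL (k : ℕ) : Continuous (p.respL k) := by
  match k with
  | 0 => exact continuous_const
  | k + 1 =>
    have e : p.respL (k + 1) = fun ω : ℝ => if k ≤ p.rank then
      (-1) ^ k * chainNum (p.rank - k) p.αR (ω / (2 * p.ω₀) : ℝ) / (p.m * p.ω₀ * p.den ω) else 0 := rfl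
    rw [e]
    by_cases h : k ≤ p.rank
    · simp only [h, if_true]
      refine Continuous.div (continuous_const.mul ((continuous_chainNum _ _).comp (by fun_prop))) ?_
        p.prefactor_ne_zero
      exact continuous_const.mul p.continuous_den
    · simp only [h, if_false]
      exact continuous_const

lemma respR_last (ω : ℝ) : p.respR (p.rank + 2) ω = 0 := by simp [respR]

lemma respL_last (ω : ℝ) : p.respL (p.rank + 2) ω = 0 := by simp [respL]

/-- Ratio of left damping constant to mass, in terms of the dimensionless constant. -/
lemma ηL_div_m : p.ηL / p.m = 2 * p.αL * p.ω₀ := by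
  have := p.ω₀_pos; have := p.m_pos; unfold αL; field_simp

lemma ηR_div_m : p.ηR / p.m = 2 * p.αR * p.ω₀ := by
  have := p.ω₀_pos; have := p.m_pos; unfold αR; field_simp

/-- The unforced left row starts `chainNum` with damping `αL`, the bulk rows continue it, and the
forced right row produces `chainDen`, which fixes the normalization. -/
lemma respR_eq {k : ℕ} (hk : k ≤ p.rank) (ω : ℝ) :
    -Complex.I * ω * p.respR (k + 1) ω
      = p.ω₀ * (p.respR (k + 2) ω - p.respR k ω)
        + (if k = 0 then 0 - (p.ηL / p.m : ℝ) * p.respR 1 ω else 0)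
        + (if k = p.rank then (1 / p.m : ℝ) - (p.ηR / p.m : ℝ) * p.respR (p.rank + 1) ω
            else 0) := by
  have h1 : (p.m : ℂ) ≠ 0 := by exact_mod_cast p.m_pos.ne'
  have h2 : (p.ω₀ : ℂ) ≠ 0 := by exact_mod_cast p.ω₀_pos.ne'
  have h3 := p.den_ne_zero ω
  have hr := p.two_le_rank
  have hs : (ω : ℂ) = 2 * p.ω₀ * ((ω / (2 * p.ω₀) : ℝ) : ℂ) := by push_cast; field_simp
  have hd : p.den ω = _ := chainDen_eq_chainNum p.rank p.αL p.αR (ω / (2 * p.ω₀) : ℝ)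
  rw [ηL_div_m, ηR_div_m]
  generalize hsd : ((ω / (2 * p.ω₀) : ℝ) : ℂ) = s at hs hd
  match k with
  | 0 =>
    have n1 : ¬ 0 = p.rank := by omega
    have n2 : 0 + 1 ≤ p.rank := by omega
    simp only [respR, n1, n2, hk, if_true, if_false, hsd, hs, chainNum_one,
      chainNum_zero]
    push_cast
    field_simp
    ring
  | k + 1 =>
    have n1 : k ≤ p.rank := by omega
    by_cases hkr : k + 1 = p.rank
    · have m1 : k ≤ k + 1 := by omega
      have m2 : ¬ k + 1 + 1 ≤ k + 1 := by omega
      rw [← hkr] at hd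
      simp only [respR, m1, m2, if_true, if_false, hsd, hs, ← hkr, le_refl,
        Nat.succ_ne_zero]
      rw [chainNum_add_two] at hd
      push_cast
      field_simp
      linear_combination -hd
    · have n2 : k + 1 + 1 ≤ p.rank := by omega
      simp only [respR, n1, n2, hk, hkr, if_true, if_false, hsd, hs, Nat.succ_ne_zero,
        chainNum_add_two]
      field_simp
      ring

/-- Mirror image of `respR_eq`, started at the right end; running the recursion backwards flips a
sign at each step, hence the factor `(-1) ^ k`. -/
lemma respL_eq {k : ℕ} (hk : k ≤ p.rank) (ω : ℝ) :
    -Complex.I * ω * p.respL (k + 1) ω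
      = p.ω₀ * (p.respL (k + 2) ω - p.respL k ω)
        + (if k = 0 then (1 / p.m : ℝ) - (p.ηL / p.m : ℝ) * p.respL 1 ω else 0)
        + (if k = p.rank then 0 - (p.ηR / p.m : ℝ) * p.respL (p.rank + 1) ω
            else 0) := by
  have h1 : (p.m : ℂ) ≠ 0 := by exact_mod_cast p.m_pos.ne'
  have h2 : (p.ω₀ : ℂ) ≠ 0 := by exact_mod_cast p.ω₀_pos.ne'
  have h3 := p.den_ne_zero ω
  have hr := p.two_le_rank
  have hs : (ω : ℂ) = 2 * p.ω₀ * ((ω / (2 * p.ω₀) : ℝ) : ℂ) := by push_cast; field_simp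
  have hd : p.den ω = _ := (chainDen_comm _ _ _ _).trans
    (chainDen_eq_chainNum p.rank p.αR p.αL (ω / (2 * p.ω₀) : ℝ))
  rw [ηL_div_m, ηR_div_m]
  generalize hsd : ((ω / (2 * p.ω₀) : ℝ) : ℂ) = s at hs hd
  match k with
  | 0 =>
    have n1 : ¬ 0 = p.rank := by omega
    have n2 : 0 + 1 ≤ p.rank := by omega
    obtain ⟨q, hq⟩ : ∃ q, p.rank = q + 1 := ⟨p.rank - 1, by omega⟩
    rw [hq, chainNum_add_two] at hd
    have hq1 : p.rank - (0 + 1) = q := by omega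
    have hq2 : p.rank - 0 = q + 1 := by omega
    simp only [respL, n1, n2, if_true, if_false, Nat.zero_le, hsd, hs, hq1, hq2]
    push_cast
    field_simp
    linear_combination -hd
  | k + 1 =>
    have n1 : k ≤ p.rank := by omega
    by_cases hkr : k + 1 = p.rank
    · have m1 : k ≤ k + 1 := by omega
      have m2 : ¬ k + 1 + 1 ≤ k + 1 := by omega
      have hq1 : k + 1 - k = 1 := by omega
      simp only [respL, m1, m2, if_true, if_false, hsd, hs, ← hkr, le_refl,
        Nat.succ_ne_zero, Nat.sub_self, hq1, chainNum_zero, chainNum_one]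
      push_cast
      field_simp
      ring
    · have n2 : k + 1 + 1 ≤ p.rank := by omega
      obtain ⟨q, hq⟩ : ∃ q, p.rank = q + (k + 2) := ⟨p.rank - (k + 2), by omega⟩
      have hq0 : p.rank - k = q + 2 := by omega
      have hq1 : p.rank - (k + 1) = q + 1 := by omega
      have hq2 : p.rank - (k + 1 + 1) = q := by omega
      simp only [respL, n1, n2, hk, hkr, if_true, if_false, hsd, hs, Nat.succ_ne_zero,
        hq0, hq1, hq2, chainNum_add_two]
      field_simp
      ring

/-- Squared modulus of the transmission amplitude of the chain. -/
def transmission (ω : ℝ) : ℝ := 1 / ((p.m * p.ω₀) ^ 2 * Complex.normSq (p.den ω))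

/-- Together with `normSq_respL_last` this is reciprocity: both end-to-end amplitudes have numerator
`chainNum 0 = 1`. -/
lemma normSq_respR_one (ω : ℝ) : Complex.normSq (p.respR 1 ω) = p.transmission ω := by
  simp [respR, transmission, chainNum_zero, Complex.normSq_ofReal]
  left
  ring

lemma normSq_respL_last (ω : ℝ) :
    Complex.normSq (p.respL (p.rank + 1) ω) = p.transmission ω := by
  simp [respL, transmission, chainNum_zero, Complex.normSq_ofReal, p.even_rank.neg_one_pow]
  left
  ring

/-- Energy balance at one frequency: power injected by a unit left force equals dissipation on the
left plus dissipation on the right. -/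
lemma re_respL_one (ω : ℝ) : (p.respL 1 ω).re
    = p.ηL * Complex.normSq (p.respL 1 ω) + p.ηR * p.transmission ω := by
  have key := re_chainNum_mul_conj_chainDen p.even_rank p.αL p.αR (ω / (2 * p.ω₀))
  have hd := p.den_ne_zero ω
  have hn : 0 < Complex.normSq (p.den ω) := Complex.normSq_pos.2 hd
  have h1 := p.m_pos
  have h2 := p.ω₀_pos
  have e : p.respL 1 ω = ((1 / (p.m * p.ω₀ * Complex.normSq (p.den ω)) : ℝ) : ℂ)
      * (chainNum p.rank p.αR (ω / (2 * p.ω₀) : ℝ) * conj (p.den ω)) := by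
    have h1 : (p.m : ℂ) ≠ 0 := by exact_mod_cast p.m_pos.ne'
    have h2 : (p.ω₀ : ℂ) ≠ 0 := by exact_mod_cast p.ω₀_pos.ne'
    have hd' : conj (p.den ω) ≠ 0 := by simpa using hd
    push_cast
    rw [← Complex.mul_conj]
    simp [respL]
    field_simp
  rw [e, Complex.re_ofReal_mul, Complex.normSq_mul, Complex.normSq_mul, Complex.normSq_conj,
    Complex.normSq_ofReal, transmission]
  change _ * (_ * conj (chainDen p.rank p.αL p.αR _)).re = _
  rw [key]
  have hL : p.ηL = 2 * p.αL * p.ω₀ * p.m := by rw [← ηL_div_m]; field_simp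
  have hR : p.ηR = 2 * p.αR * p.ω₀ * p.m := by rw [← ηR_div_m]; field_simp
  rw [hL, hR]
  field_simp

lemma re_respR_last (ω : ℝ) : (p.respR (p.rank + 1) ω).re
    = p.ηR * Complex.normSq (p.respR (p.rank + 1) ω) + p.ηL * p.transmission ω := by
  have key := re_chainNum_mul_conj_chainDen p.even_rank p.αR p.αL (ω / (2 * p.ω₀))
  rw [chainDen_comm] at key
  have hd := p.den_ne_zero ω
  have hn : 0 < Complex.normSq (p.den ω) := Complex.normSq_pos.2 hd
  have h1 := p.m_pos
  have h2 := p.ω₀_pos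
  have e : p.respR (p.rank + 1) ω = ((1 / (p.m * p.ω₀ * Complex.normSq (p.den ω)) : ℝ) : ℂ)
      * (chainNum p.rank p.αL (ω / (2 * p.ω₀) : ℝ) * conj (p.den ω)) := by
    have h1 : (p.m : ℂ) ≠ 0 := by exact_mod_cast p.m_pos.ne'
    have h2 : (p.ω₀ : ℂ) ≠ 0 := by exact_mod_cast p.ω₀_pos.ne'
    have hd' : conj (p.den ω) ≠ 0 := by simpa using hd
    push_cast
    rw [← Complex.mul_conj]
    simp [respR]
    field_simp
  rw [e, Complex.re_ofReal_mul, Complex.normSq_mul, Complex.normSq_mul, Complex.normSq_conj,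
    Complex.normSq_ofReal, transmission]
  change _ * (_ * conj (chainDen p.rank p.αL p.αR _)).re = _
  rw [key]
  have hL : p.ηL = 2 * p.αL * p.ω₀ * p.m := by rw [← ηL_div_m]; field_simp
  have hR : p.ηR = 2 * p.αR * p.ω₀ * p.m := by rw [← ηR_div_m]; field_simp
  rw [hL, hR]
  field_simp

end HarmonicChain

/-! ### Stationary correlations -/

lemma ChainODE.add {r : ℕ} {w a b : ℝ} {z z' : ℕ → ℝ → ℝ} {fl fr fl' fr' : ℝ → ℝ}
    (h : ChainODE r w a b z fl fr) (h' : ChainODE r w a b z' fl' fr') :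
    ChainODE r w a b (fun k t => z k t + z' k t) (fun t => fl t + fl' t)
      (fun t => fr t + fr' t) where
  left t := by simp [h.left, h'.left]
  right t := by simp [h.right, h'.right]
  deriv k hk t ht := by
    refine ((h.deriv k hk t ht).add (h'.deriv k hk t ht)).congr_deriv ?_
    split_ifs <;> ring

lemma re_fourierMoment_neg (Ω : ℝ) (f : ℝ → ℂ) (τ : ℝ) :
    (fourierMoment Ω (fun ω => conj (f ω)) (-τ)).re = (fourierMoment Ω f τ).re := by
  rw [← conj_fourierMoment, Complex.conj_re]

namespace HarmonicChain

variable (p : HarmonicChain)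

/-- Equations of motion of the chain `p`, in terms of velocities and bond lengths. -/
abbrev Motion (z : ℕ → ℝ → ℝ) (fl fr : ℝ → ℝ) : Prop :=
  ChainODE p.rank p.ω₀ (p.ηL / p.m) (p.ηR / p.m) z fl fr

variable {Ω : ℝ} {g : ℝ → ℂ}

lemma motion_respL (hg : IntervalIntegrable g volume 0 Ω) (t' : ℝ) :
    p.Motion (fun k t => (fourierMoment Ω (fun ω => g ω * p.respL k ω) (t' - t)).re)
      (fun t => 1 / p.m * (fourierMoment Ω g (t' - t)).re) (fun _ => 0) := by
  have := ChainODE.of_modes (Ω := Ω) (r := p.rank) (w := p.ω₀) (a := p.ηL / p.m) (b := p.ηR / p.m)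
    (h := fun k ω => g ω * p.respL k ω) (gl := fun ω => (1 / p.m : ℝ) * g ω) (gr := fun _ => 0)
    (fun k => hg.mul_continuousOn (p.continuous_respL k).continuousOn) (hg.const_mul _)
    intervalIntegrable_const (fun ω => by simp [respL]) (fun ω => by simp [respL_last])
    (fun k hk ω => by
      have := congrArg (g ω * ·) (p.respL_eq hk ω)
      calc _ = g ω * (-Complex.I * ω * p.respL (k + 1) ω) := by ring
        _ = _ := this
        _ = _ := by split_ifs <;> ring) t'
  simpa only [fourierMoment_const_mul, fourierMoment_zero, Complex.re_ofReal_mul,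
    Complex.zero_re] using this

lemma motion_respR (hg : IntervalIntegrable g volume 0 Ω) (t' : ℝ) :
    p.Motion (fun k t => (fourierMoment Ω (fun ω => g ω * p.respR k ω) (t' - t)).re)
      (fun _ => 0) (fun t => 1 / p.m * (fourierMoment Ω g (t' - t)).re) := by
  have := ChainODE.of_modes (Ω := Ω) (r := p.rank) (w := p.ω₀) (a := p.ηL / p.m) (b := p.ηR / p.m)
    (h := fun k ω => g ω * p.respR k ω) (gl := fun _ => 0) (gr := fun ω => (1 / p.m : ℝ) * g ω)
    (fun k => hg.mul_continuousOn (p.continuous_respR k).continuousOn)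
    intervalIntegrable_const (hg.const_mul _)
    (fun ω => by simp [respR]) (fun ω => by simp [respR_last])
    (fun k hk ω => by
      have := congrArg (g ω * ·) (p.respR_eq hk ω)
      calc _ = g ω * (-Complex.I * ω * p.respR (k + 1) ω) := by ring
        _ = _ := this
        _ = _ := by split_ifs <;> ring) t'
  simpa only [fourierMoment_const_mul, fourierMoment_zero, Complex.re_ofReal_mul,
    Complex.zero_re] using this

/-- Stationary correlation of the chain with the left force. -/
def corrL (Ω : ℝ) (k : ℕ) (τ : ℝ) : ℝ :=
  (fourierMoment Ω (fun ω => p.noiseWeight p.ηL p.TL ω * p.respL k ω) τ).re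

/-- Stationary correlation of the chain with the right force. -/
def corrR (Ω : ℝ) (k : ℕ) (τ : ℝ) : ℝ :=
  (fourierMoment Ω (fun ω => p.noiseWeight p.ηR p.TR ω * p.respR k ω) τ).re

/-- Stationary covariance of the chain. -/
def corrZ (Ω : ℝ) (k l : ℕ) (τ : ℝ) : ℝ :=
  (fourierMoment Ω (fun ω => p.noiseWeight p.ηL p.TL ω * conj (p.respL l ω) * p.respL k ω) τ).re
  + (fourierMoment Ω (fun ω => p.noiseWeight p.ηR p.TR ω * conj (p.respR l ω) * p.respR k ω) τ).re

lemma motion_corrL (Ω t' : ℝ) : p.Motion (fun k t => p.corrL Ω k (t' - t))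
    (fun t => p.noiseCorrelation p.ηL p.TL Ω (t' - t) / p.m) (fun _ => 0) := by
  have e : (fun t => p.noiseCorrelation p.ηL p.TL Ω (t' - t) / p.m) = fun t =>
      1 / p.m * (fourierMoment Ω (fun ω => (p.noiseWeight p.ηL p.TL ω : ℂ)) (t' - t)).re := by
    ext t
    rw [p.noiseCorrelation_eq p.TL_pos]
    ring
  rw [e]
  exact p.motion_respL (p.intervalIntegrable_noiseWeight_ofReal p.ηL p.TL_pos 0 Ω) t'

lemma motion_corrR (Ω t' : ℝ) : p.Motion (fun k t => p.corrR Ω k (t' - t))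
    (fun _ => 0) (fun t => p.noiseCorrelation p.ηR p.TR Ω (t' - t) / p.m) := by
  have e : (fun t => p.noiseCorrelation p.ηR p.TR Ω (t' - t) / p.m) = fun t =>
      1 / p.m * (fourierMoment Ω (fun ω => (p.noiseWeight p.ηR p.TR ω : ℂ)) (t' - t)).re := by
    ext t
    rw [p.noiseCorrelation_eq p.TR_pos]
    ring
  rw [e]
  exact p.motion_respR (p.intervalIntegrable_noiseWeight_ofReal p.ηR p.TR_pos 0 Ω) t'

/-- As a function of `t`, the covariance is driven by the correlation of the force at `t` with the
chain at `t'`. The roles of the two times are reversed relative to `corrL` and `corrR`, whence the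
lag `t - t'` and the conjugated response. -/
lemma motion_corrZ (Ω t' : ℝ) (l : ℕ) : p.Motion (fun k t => p.corrZ Ω k l (t' - t))
    (fun t => p.corrL Ω l (t - t') / p.m) (fun t => p.corrR Ω l (t - t') / p.m) := by
  have hl : IntervalIntegrable (fun ω => (p.noiseWeight p.ηL p.TL ω : ℂ) * conj (p.respL l ω))
      volume 0 Ω :=
    (p.intervalIntegrable_noiseWeight_ofReal p.ηL p.TL_pos 0 Ω).mul_continuousOn
      (Complex.continuous_conj.comp (p.continuous_respL l)).continuousOn
  have hr : IntervalIntegrable (fun ω => (p.noiseWeight p.ηR p.TR ω : ℂ) * conj (p.respR l ω))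
      volume 0 Ω :=
    (p.intervalIntegrable_noiseWeight_ofReal p.ηR p.TR_pos 0 Ω).mul_continuousOn
      (Complex.continuous_conj.comp (p.continuous_respR l)).continuousOn
  have eL : (fun t => p.corrL Ω l (t - t') / p.m) = fun t =>
      1 / p.m * (fourierMoment Ω (fun ω => p.noiseWeight p.ηL p.TL ω * conj (p.respL l ω))
        (t' - t)).re + 0 := by
    ext t
    rw [corrL, ← re_fourierMoment_neg, neg_sub]
    simp only [map_mul, Complex.conj_ofReal]
    ring
  have eR : (fun t => p.corrR Ω l (t - t') / p.m) = fun t =>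
      0 + 1 / p.m * (fourierMoment Ω (fun ω => p.noiseWeight p.ηR p.TR ω * conj (p.respR l ω))
        (t' - t)).re := by
    ext t
    rw [corrR, ← re_fourierMoment_neg, neg_sub]
    simp only [map_mul, Complex.conj_ofReal]
    ring
  rw [eL, eR]
  exact (p.motion_respL hl t').add (p.motion_respR hr t')

lemma corrZ_comm (Ω : ℝ) (k l : ℕ) (τ : ℝ) : p.corrZ Ω k l τ = p.corrZ Ω l k (-τ) := by
  unfold corrZ
  rw [← re_fourierMoment_neg Ω _ τ, ← re_fourierMoment_neg Ω _ τ]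
  simp only [map_mul, Complex.conj_ofReal, Complex.conj_conj, mul_right_comm]

end HarmonicChain

/-! ### Reduction of the quantum dynamics to scalar equations -/

namespace LangevinDynamics

variable {p : HarmonicChain} {Ω : ℝ} {𝒜 : Type u} [Ring 𝒜] [StarRing 𝒜] [Algebra ℂ 𝒜]
  (S : LangevinDynamics p Ω 𝒜)

/-- Velocities and rescaled bond lengths, in spatial order. -/
def mode : ℕ → ℝ → 𝒜
  | 0, _ => 0
  | k + 1, t => if k ≤ p.rank then
      (if Even k then S.V (k / 2 + 1) t
        else (p.ω₀ : ℂ) • (S.X (k / 2 + 2) t - S.X (k / 2 + 1) t)) else 0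

lemma mode_zero (t : ℝ) : S.mode 0 t = 0 := rfl

lemma mode_last (t : ℝ) : S.mode (p.rank + 2) t = 0 := by simp [mode]

lemma mode_velocity {j : ℕ} (hj : j + 1 ≤ p.N) (t : ℝ) : S.mode (2 * j + 1) t = S.V (j + 1) t := by
  have h : 2 * j ≤ p.rank := by unfold HarmonicChain.rank; omega
  simp [mode, h]

lemma mode_bond {j : ℕ} (hj : j + 2 ≤ p.N) (t : ℝ) :
    S.mode (2 * j + 2) t = (p.ω₀ : ℂ) • (S.X (j + 2) t - S.X (j + 1) t) := by
  have h : 2 * j + 1 ≤ p.rank := by unfold HarmonicChain.rank; omega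
  have h1 : (2 * j + 1) / 2 = j := by omega
  simp [mode, h, h1]

variable [StarModule ℂ 𝒜]

/-- The element `c` is arbitrary: it will be a force or a mode at another time. Even `k` are the
equations of motion of the masses, odd `k` the kinematics of the bonds. -/
lemma motion_mode (c : 𝒜) : p.Motion (fun k t => S.state.inner (S.mode k t) c)
    (fun t => S.state.inner (S.FL t) c / p.m) (fun t => S.state.inner (S.FR t) c / p.m) where
  left t := by rw [mode_zero, StarState.inner_zero_left]
  right t := by rw [mode_last, StarState.inner_zero_left]
  deriv k hk t ht := by
    have hN := p.two_le_N
    have hrk : p.rank = 2 * (p.N - 1) := rfl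
    rcases k.even_or_odd' with ⟨j, rfl | rfl⟩
    · have hj : j + 1 ≤ p.N := by omega
      have e1 : (fun t => S.state.inner (S.mode (2 * j + 1) t) c)
          = fun t => S.state.inner (S.V (j + 1) t) c := by
        ext t; rw [S.mode_velocity hj]
      rw [e1]
      refine (S.V_deriv (j + 1) (by omega) hj t ht).hasDerivAt_inner c |>.congr_deriv ?_
      have smul : ∀ (x : ℝ) (a : 𝒜), S.state.inner ((x : ℂ) • a) c = x * S.state.inner a c :=
        fun x a => S.state.inner_smul_left x a c
      by_cases h0 : j = 0
      · subst h0
        have n1 : ¬ 2 * 0 = p.rank := by omega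
        have e := S.eq_left t ht
        have e2 : S.W 1 t = ((1 / p.m : ℝ) : ℂ) • S.FL t
            - ((p.ηL / p.m : ℝ) : ℂ) • S.V 1 t
            + ((p.ω₀ : ℝ) : ℂ) • ((p.ω₀ : ℝ) : ℂ) • (S.X 2 t - S.X 1 t) := by
          push_cast; rw [← e]; module
        rw [S.mode_bond (by omega), mode_zero, S.mode_velocity (j := 0) (by omega), if_neg n1,
          if_pos rfl, e2, StarState.inner_add_left, StarState.inner_sub_left, smul, smul, smul,
          StarState.inner_zero_left]
        ring
      · have n0 : ¬ 2 * j = 0 := by omega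
        obtain ⟨i, rfl⟩ : ∃ i, j = i + 1 := ⟨j - 1, by omega⟩
        rw [show 2 * (i + 1) = 2 * i + 2 by ring] at n0 hk ⊢
        rw [S.mode_bond (j := i) (by omega), if_neg n0]
        by_cases h1 : i + 2 = p.N
        · have n1 : 2 * i + 2 = p.rank := by omega
          have n2 : p.rank + 1 = 2 * (i + 1) + 1 := by omega
          have e := S.eq_right t ht
          rw [← h1, show i + 2 - 1 = i + 1 by omega] at e
          have e2 : S.W (i + 1 + 1) t = ((1 / p.m : ℝ) : ℂ) • S.FR t
              - ((p.ηR / p.m : ℝ) : ℂ) • S.V (i + 1 + 1) t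
              - ((p.ω₀ : ℝ) : ℂ) • ((p.ω₀ : ℝ) : ℂ) • (S.X (i + 2) t - S.X (i + 1) t) := by
            push_cast; rw [← e]; module
          rw [if_pos n1, show 2 * i + 2 + 2 = p.rank + 2 by omega, mode_last, n2,
            S.mode_velocity (j := i + 1) (by omega), e2, StarState.inner_sub_left,
            StarState.inner_sub_left, smul, smul, smul, StarState.inner_zero_left]
          rw [smul]
          ring
        · have n1 : ¬ 2 * i + 2 = p.rank := by omega
          have e := S.eq_bulk (i + 2) (by omega) (by omega) t ht
          rw [show i + 2 - 1 = i + 1 by omega] at e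
          have e2 : S.W (i + 1 + 1) t
              = ((p.ω₀ : ℝ) : ℂ) • ((p.ω₀ : ℝ) : ℂ) • (S.X (i + 1 + 2) t - S.X (i + 1 + 1) t)
              - ((p.ω₀ : ℝ) : ℂ) • ((p.ω₀ : ℝ) : ℂ) • (S.X (i + 2) t - S.X (i + 1) t) := by
            rw [← sub_eq_zero, ← e]; module
          rw [if_neg n1, show 2 * i + 2 + 2 = 2 * (i + 1) + 2 by ring,
            S.mode_bond (j := i + 1) (by omega), e2, StarState.inner_sub_left, smul, smul]
          rw [smul, smul]
          ring
    · have hj : j + 2 ≤ p.N := by omega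
      have e1 : (fun t => S.state.inner (S.mode (2 * j + 1 + 1) t) c)
          = fun t => p.ω₀ * (S.state.inner (S.X (j + 2) t) c - S.state.inner (S.X (j + 1) t) c) := by
        ext t
        rw [S.mode_bond hj, StarState.inner_smul_left, StarState.inner_sub_left]
      have n0 : ¬ 2 * j + 1 = 0 := by omega
      have n1 : ¬ 2 * j + 1 = p.rank := by omega
      rw [e1, if_neg n0, if_neg n1, S.mode_velocity (j := j) (by omega),
        show 2 * j + 1 + 2 = 2 * (j + 1) + 1 by ring, S.mode_velocity (j := j + 1) (by omega),
        add_zero, add_zero]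
      exact (((S.X_deriv (j + 2) (by omega) hj t ht).hasDerivAt_inner c).sub
        ((S.X_deriv (j + 1) (by omega) (by omega) t ht).hasDerivAt_inner c)).const_mul p.ω₀

end LangevinDynamics

/-! ### Relaxation of the correlations -/

namespace LangevinDynamics

variable {p : HarmonicChain} {Ω : ℝ} {𝒜 : Type u} [Ring 𝒜] [StarRing 𝒜] [Algebra ℂ 𝒜]
  (S : LangevinDynamics p Ω 𝒜)

/-- The equal-time correlation of the chain with a force relaxes. -/
lemma tendsto_force_correlation {F : ℝ → 𝒜} {u : ℕ → ℝ → ℝ}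
    (h : ∃ A ≥ 0, ∃ c > 0, ∀ t', ∀ t ≥ 1, ∀ k ≤ p.rank,
      (S.state.inner (S.mode (k + 1) t) (F t') - u (k + 1) (t' - t)) ^ 2
        ≤ A * Real.exp (-c * (t - 1))) {k : ℕ} (hk : k ≤ p.rank) :
    Tendsto (fun t => S.state.inner (S.mode (k + 1) t) (F t)) atTop (𝓝 (u (k + 1) 0)) := by
  obtain ⟨A, hA, c, hc, h⟩ := h
  have hlim : Tendsto (fun t : ℝ => A * Real.exp (-c * (t - 1))) atTop (𝓝 0) := by
    have : Tendsto (fun t : ℝ => Real.exp (-c * (t - 1))) atTop (𝓝 0) := Real.tendsto_exp_atBot.comp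
      ((tendsto_atTop_add_const_right _ (-1) tendsto_id).const_mul_atTop_of_neg (by linarith))
    simpa using this.const_mul A
  have h0 : Tendsto (fun t => S.state.inner (S.mode (k + 1) t) (F t) - u (k + 1) 0) atTop
      (𝓝 0) := by
    have hs := hlim.sqrt
    rw [Real.sqrt_zero] at hs
    refine squeeze_zero_norm' ?_ hs
    filter_upwards [eventually_ge_atTop 1] with t ht
    refine Real.abs_le_sqrt ?_
    -- Uniformity in the observation time `t'` permits the choice `t' = t`.
    simpa using h t t ht k hk
  simpa using h0.add_const (u (k + 1) 0)

variable [StarModule ℂ 𝒜]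

lemma inner_FL_FL (t t' : ℝ) :
    S.state.inner (S.FL t) (S.FL t') = p.noiseCorrelation p.ηL p.TL Ω (t' - t) := by
  have h := S.FL_corr t t'
  rw [S.state.sym_eq_inner (S.FL_selfAdjoint t) (S.FL_selfAdjoint t')] at h
  exact_mod_cast h

lemma inner_FR_FR (t t' : ℝ) :
    S.state.inner (S.FR t) (S.FR t') = p.noiseCorrelation p.ηR p.TR Ω (t' - t) := by
  have h := S.FR_corr t t'
  rw [S.state.sym_eq_inner (S.FR_selfAdjoint t) (S.FR_selfAdjoint t')] at h
  exact_mod_cast h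

lemma inner_FL_FR (t t' : ℝ) : S.state.inner (S.FL t) (S.FR t') = 0 := by
  have h := S.FL_FR_corr t t'
  rw [S.state.sym_eq_inner (S.FL_selfAdjoint t) (S.FR_selfAdjoint t')] at h
  exact_mod_cast h

lemma inner_FR_FL (t t' : ℝ) : S.state.inner (S.FR t) (S.FL t') = 0 := by
  rw [StarState.inner_comm, inner_FL_FR]

/-- The correlation of the chain with a force relaxes to its stationary value, uniformly in the
time at which the force is observed. -/
lemma exists_force_relaxation (F : ℝ → 𝒜) (u : ℕ → ℝ → ℝ)
    (hu : ∀ t', p.Motion (fun k t => u k (t' - t)) (fun t => S.state.inner (S.FL t) (F t') / p.m)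
      (fun t => S.state.inner (S.FR t) (F t') / p.m))
    (v : ℝ) (hF : ∀ t', S.state.inner (F t') (F t') = v)
    (b : ℕ → ℝ) (hb : ∀ k τ, |u k τ| ≤ b k) :
    ∃ A ≥ 0, ∃ c > 0, ∀ t', ∀ t ≥ 1, ∀ k ≤ p.rank,
      (S.state.inner (S.mode (k + 1) t) (F t') - u (k + 1) (t' - t)) ^ 2
        ≤ A * Real.exp (-c * (t - 1)) := by
  obtain ⟨C, hC, c, hc, H⟩ := exists_chain_stability p.two_le_rank p.ω₀_pos
    (div_pos p.ηL_pos p.m_pos) (div_pos p.ηR_pos p.m_pos)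
  have hv : 0 ≤ v := (S.state.inner_self_nonneg _).trans_eq (hF 0)
  -- Bounds the deviation at time `1` uniformly in `t'`, by Cauchy-Schwarz and the constancy in time
  -- of the force variance `v`.
  set a : ℕ → ℝ := fun k =>
    2 * (S.state.inner (S.mode (k + 1) 1) (S.mode (k + 1) 1) * v + b (k + 1) ^ 2)
  have ha : ∀ k, 0 ≤ a k := fun k => by
    have := S.state.inner_self_nonneg (S.mode (k + 1) 1)
    positivity
  set A := ∑ k ∈ Finset.range (p.rank + 1), a k
  have hA : 0 ≤ A := Finset.sum_nonneg fun k _ => ha k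
  refine ⟨C * A, by positivity, c, hc, fun t' t ht k hk => ?_⟩
  -- The driving bound is `0`: both solutions have the same prescribed forcing, so their difference
  -- is unforced.
  have := H _ _ _ A 0 1 one_pos le_rfl ((S.motion_mode (F t')).sub (hu t')) (fun k hk => ?_)
    (fun t _ => by simp) (fun t _ => by simp) t ht k hk
  · rwa [add_zero, ← mul_assoc] at this
  · have h1 : a k ≤ A := Finset.single_le_sum (f := a) (fun k _ => ha k)
      (Finset.mem_range.2 (by omega))
    refine le_trans ?_ h1
    have h2 := S.state.inner_sq_le (S.mode (k + 1) 1) (F t')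
    rw [hF] at h2
    have h3 : u (k + 1) (t' - 1) ^ 2 ≤ b (k + 1) ^ 2 :=
      sq_le_sq' (abs_le.1 (hb _ _)).1 (abs_le.1 (hb _ _)).2
    nlinarith [sq_nonneg (S.state.inner (S.mode (k + 1) 1) (F t') + u (k + 1) (t' - 1))]

/-- The covariance of the chain relaxes to a stationary value if its correlations with the forces
do. -/
lemma tendsto_covariance (uL uR : ℕ → ℝ → ℝ) (K : ℕ → ℕ → ℝ → ℝ)
    (hL : ∃ A ≥ 0, ∃ c > 0, ∀ t', ∀ t ≥ 1, ∀ k ≤ p.rank,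
      (S.state.inner (S.mode (k + 1) t) (S.FL t') - uL (k + 1) (t' - t)) ^ 2
        ≤ A * Real.exp (-c * (t - 1)))
    (hR : ∃ A ≥ 0, ∃ c > 0, ∀ t', ∀ t ≥ 1, ∀ k ≤ p.rank,
      (S.state.inner (S.mode (k + 1) t) (S.FR t') - uR (k + 1) (t' - t)) ^ 2
        ≤ A * Real.exp (-c * (t - 1)))
    (hK : ∀ l t', p.Motion (fun k t => K k l (t' - t)) (fun t => uL l (t - t') / p.m)
      (fun t => uR l (t - t') / p.m))
    (hcomm : ∀ k l τ, K k l τ = K l k (-τ)) {k : ℕ} (hk : k ≤ p.rank) :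
    Tendsto (fun t => S.state.inner (S.mode (k + 1) t) (S.mode (k + 1) t)) atTop
      (𝓝 (K (k + 1) (k + 1) 0)) := by
  obtain ⟨C, hC, c, hc, H⟩ := exists_chain_stability p.two_le_rank p.ω₀_pos
    (div_pos p.ηL_pos p.m_pos) (div_pos p.ηR_pos p.m_pos)
  obtain ⟨AL, hAL, cL, hcL, hL⟩ := hL
  obtain ⟨AR, hAR, cR, hcR, hR⟩ := hR
  set E : ℕ → ℕ → ℝ → ℝ → ℝ := fun k l t t' =>
    S.state.inner (S.mode k t) (S.mode l t') - K k l (t' - t) with hE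
  set B : ℝ → ℝ := fun t' =>
    (AL * Real.exp (-cL * (t' - 1)) + AR * Real.exp (-cR * (t' - 1))) / p.m ^ 2 with hB
  have hBpos : ∀ t', 0 ≤ B t' := fun t' => by positivity
  have hm := p.m_pos
  -- At fixed `t'` the deviation evolves in `t`, driven by the deviation of the force correlations.
  -- That driving need not decay in `t`, but it is bounded by `B t'`, which decays in `t'`.
  have step : ∀ A, ∀ l ≤ p.rank, ∀ t' ≥ 1, (∀ k ≤ p.rank, E (k + 1) (l + 1) 1 t' ^ 2 ≤ A) →
      ∀ t ≥ 1, ∀ k ≤ p.rank,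
        E (k + 1) (l + 1) t t' ^ 2 ≤ C * (A * Real.exp (-c * (t - 1)) + B t') := by
    intro A l hl t' ht' hA t ht k hk
    have bound : ∀ (F : ℝ → 𝒜) (u : ℕ → ℝ → ℝ) (A c : ℝ), A * Real.exp (-c * (t' - 1)) / p.m ^ 2
        ≤ B t' → (∀ s, ∀ t ≥ 1, ∀ k ≤ p.rank,
          (S.state.inner (S.mode (k + 1) t) (F s) - u (k + 1) (s - t)) ^ 2
            ≤ A * Real.exp (-c * (t - 1))) → ∀ s,
        (S.state.inner (F s) (S.mode (l + 1) t') / p.m - u (l + 1) (s - t') / p.m) ^ 2 ≤ B t' := by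
      intro F u A c h1 h2 s
      refine le_trans ?_ h1
      rw [← sub_div, div_pow, StarState.inner_comm]
      exact div_le_div_of_nonneg_right (h2 s t' ht' l hl) (by positivity)
    refine H _ _ _ A (B t') 1 one_pos (hBpos t') ((S.motion_mode (S.mode (l + 1) t')).sub
      (hK (l + 1) t')) hA (fun s _ => bound S.FL uL AL cL ?_ hL s)
      (fun s _ => bound S.FR uR AR cR ?_ hR s) t ht k hk
    · exact div_le_div_of_nonneg_right (le_add_of_nonneg_right (by positivity)) (by positivity)
    · exact div_le_div_of_nonneg_right (le_add_of_nonneg_left (by positivity)) (by positivity)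
  have symm : ∀ k l t t', E k l t t' = E l k t' t := by
    intro k l t t'
    simp only [hE]
    rw [StarState.inner_comm, hcomm, neg_sub]
  set A₁ := ∑ j ∈ Finset.range (p.rank + 1), ∑ i ∈ Finset.range (p.rank + 1),
    E (i + 1) (j + 1) 1 1 ^ 2
  have h1 : ∀ i ≤ p.rank, ∀ j ≤ p.rank, E (i + 1) (j + 1) 1 1 ^ 2 ≤ A₁ := fun i hi j hj =>
    (Finset.single_le_sum (f := fun i => E (i + 1) (j + 1) 1 1 ^ 2) (fun _ _ => sq_nonneg _)
      (Finset.mem_range.2 (by omega))).trans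
    (Finset.single_le_sum
      (f := fun j => ∑ i ∈ Finset.range (p.rank + 1), E (i + 1) (j + 1) 1 1 ^ 2)
      (fun _ _ => Finset.sum_nonneg fun _ _ => sq_nonneg _) (Finset.mem_range.2 (by omega)))
  have hA₁ : 0 ≤ A₁ := (sq_nonneg _).trans (h1 k hk k hk)
  -- First run, from `(1, 1)` to `(t', 1)`; exchanging the arguments gives initial data at `(1, t')`
  -- bounded uniformly in `t'`. The second run, in `h3`, goes from there to the diagonal.
  have h2 : ∀ t' ≥ 1, ∀ j ≤ p.rank, E (j + 1) (k + 1) 1 t' ^ 2 ≤ C * (A₁ + B 1) := by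
    intro t' ht' j hj
    rw [symm]
    refine (step A₁ j hj 1 le_rfl (fun i hi => h1 i hi j hj) t' ht' k hk).trans ?_
    have : Real.exp (-c * (t' - 1)) ≤ 1 := Real.exp_le_one_iff.2 (by nlinarith)
    gcongr
    exact mul_le_of_le_one_right hA₁ this
  have h3 : ∀ t ≥ 1, E (k + 1) (k + 1) t t ^ 2
      ≤ C * (C * (A₁ + B 1) * Real.exp (-c * (t - 1)) + B t) := fun t ht =>
    step _ k hk t ht (fun j hj => h2 t ht j hj) t ht k hk
  have hexp : ∀ c : ℝ, 0 < c → Tendsto (fun t : ℝ => Real.exp (-c * (t - 1))) atTop (𝓝 0) := by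
    intro c hc
    refine Real.tendsto_exp_atBot.comp ?_
    exact (tendsto_atTop_add_const_right _ (-1) tendsto_id).const_mul_atTop_of_neg (by linarith)
  have hlim : Tendsto (fun t => C * (C * (A₁ + B 1) * Real.exp (-c * (t - 1)) + B t)) atTop
      (𝓝 0) := by
    have hBl : Tendsto B atTop (𝓝 0) := by
      have := (((hexp cL hcL).const_mul AL).add ((hexp cR hcR).const_mul AR)).div_const (p.m ^ 2)
      simpa [hB] using this
    have := (((hexp c hc).const_mul (C * (A₁ + B 1))).add hBl).const_mul C
    simpa using this
  have hE0 : Tendsto (fun t => E (k + 1) (k + 1) t t) atTop (𝓝 0) := by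
    have hs := hlim.sqrt
    rw [Real.sqrt_zero] at hs
    refine squeeze_zero_norm' ?_ hs
    filter_upwards [eventually_ge_atTop 1] with t ht
    exact Real.abs_le_sqrt (h3 t ht)
  have := hE0.add_const (K (k + 1) (k + 1) 0)
  simpa [hE] using this

lemma exists_relaxation_FL (hΩ : 0 < Ω) : ∃ A ≥ 0, ∃ c > 0, ∀ t', ∀ t ≥ 1, ∀ k ≤ p.rank,
      (S.state.inner (S.mode (k + 1) t) (S.FL t') - p.corrL Ω (k + 1) (t' - t)) ^ 2
        ≤ A * Real.exp (-c * (t - 1)) := by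
  refine S.exists_force_relaxation S.FL (p.corrL Ω) (fun t' => ?_) _
    (fun t' => by rw [inner_FL_FL, sub_self]) _
    (fun k τ => (Complex.abs_re_le_norm _).trans (norm_fourierMoment_le hΩ _ τ))
  simp only [inner_FL_FL, inner_FR_FL, zero_div]
  exact p.motion_corrL Ω t'

lemma exists_relaxation_FR (hΩ : 0 < Ω) : ∃ A ≥ 0, ∃ c > 0, ∀ t', ∀ t ≥ 1, ∀ k ≤ p.rank,
      (S.state.inner (S.mode (k + 1) t) (S.FR t') - p.corrR Ω (k + 1) (t' - t)) ^ 2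
        ≤ A * Real.exp (-c * (t - 1)) := by
  refine S.exists_force_relaxation S.FR (p.corrR Ω) (fun t' => ?_) _
    (fun t' => by rw [inner_FR_FR, sub_self]) _
    (fun k τ => (Complex.abs_re_le_norm _).trans (norm_fourierMoment_le hΩ _ τ))
  simp only [inner_FR_FR, inner_FL_FR, zero_div]
  exact p.motion_corrR Ω t'

end LangevinDynamics

/-! ### The stationary current at fixed cutoff -/

namespace HarmonicChain

variable (p : HarmonicChain)

/-- Stationary heat current at noise cutoff `Ω`. -/
def cutoffCurrent (Ω : ℝ) : ℝ :=
  ∫ ω in (0 : ℝ)..Ω, p.transmission ω *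
    (p.ηR * p.noiseWeight p.ηL p.TL ω - p.ηL * p.noiseWeight p.ηR p.TR ω)

lemma re_fourierMoment_at_zero {Ω : ℝ} {f : ℝ → ℂ} (hf : IntervalIntegrable f volume 0 Ω) :
    (fourierMoment Ω f 0).re = ∫ ω in (0 : ℝ)..Ω, (f ω).re := by
  have := intervalIntegral.intervalIntegral_re hf
  simp only [RCLike.re_eq_complex_re] at this
  rw [this, fourierMoment]
  simp

lemma corrL_zero (Ω : ℝ) (k : ℕ) :
    p.corrL Ω k 0 = ∫ ω in (0 : ℝ)..Ω, p.noiseWeight p.ηL p.TL ω * (p.respL k ω).re := by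
  rw [corrL, re_fourierMoment_at_zero]
  · simp
  · exact (p.intervalIntegrable_noiseWeight_ofReal p.ηL p.TL_pos 0 Ω).mul_continuousOn
      (p.continuous_respL k).continuousOn

lemma corrR_zero (Ω : ℝ) (k : ℕ) :
    p.corrR Ω k 0 = ∫ ω in (0 : ℝ)..Ω, p.noiseWeight p.ηR p.TR ω * (p.respR k ω).re := by
  rw [corrR, re_fourierMoment_at_zero]
  · simp
  · exact (p.intervalIntegrable_noiseWeight_ofReal p.ηR p.TR_pos 0 Ω).mul_continuousOn
      (p.continuous_respR k).continuousOn

lemma intervalIntegrable_noiseL_mul {f : ℝ → ℝ} (hf : Continuous f) (Ω : ℝ) :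
    IntervalIntegrable (fun ω => p.noiseWeight p.ηL p.TL ω * f ω) volume 0 Ω :=
  (p.intervalIntegrable_noiseWeight p.ηL p.TL_pos 0 Ω).mul_continuousOn hf.continuousOn

lemma intervalIntegrable_noiseR_mul {f : ℝ → ℝ} (hf : Continuous f) (Ω : ℝ) :
    IntervalIntegrable (fun ω => p.noiseWeight p.ηR p.TR ω * f ω) volume 0 Ω :=
  (p.intervalIntegrable_noiseWeight p.ηR p.TR_pos 0 Ω).mul_continuousOn hf.continuousOn

lemma corrZ_zero (Ω : ℝ) (k : ℕ) :
    p.corrZ Ω k k 0 = ∫ ω in (0 : ℝ)..Ω,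
      (p.noiseWeight p.ηL p.TL ω * Complex.normSq (p.respL k ω)
        + p.noiseWeight p.ηR p.TR ω * Complex.normSq (p.respR k ω)) := by
  have hL := p.continuous_respL k
  have hR := p.continuous_respR k
  rw [corrZ, re_fourierMoment_at_zero, re_fourierMoment_at_zero, intervalIntegral.integral_add]
  · congr 2 <;> ext ω <;>
    rw [mul_assoc, mul_comm (conj _), Complex.mul_conj, ← Complex.ofReal_mul, Complex.ofReal_re]
  · exact p.intervalIntegrable_noiseL_mul (Complex.continuous_normSq.comp hL) Ω
  · exact p.intervalIntegrable_noiseR_mul (Complex.continuous_normSq.comp hR) Ω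
  · exact ((p.intervalIntegrable_noiseWeight_ofReal p.ηR p.TR_pos 0 Ω).mul_continuousOn
      (Complex.continuous_conj.comp hR).continuousOn).mul_continuousOn hR.continuousOn
  · exact ((p.intervalIntegrable_noiseWeight_ofReal p.ηL p.TL_pos 0 Ω).mul_continuousOn
      (Complex.continuous_conj.comp hL).continuousOn).mul_continuousOn hL.continuousOn

/-- By `re_respL_one` the left dissipation of left noise drops out of the power. What remains is
left noise dissipated on the right, minus right noise dissipated on the left. -/
lemma corrL_sub_eq_cutoffCurrent (Ω : ℝ) :
    p.corrL Ω 1 0 - p.ηL * p.corrZ Ω 1 1 0 = p.cutoffCurrent Ω := by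
  have hL := p.continuous_respL 1
  have hR := p.continuous_respR 1
  rw [corrL_zero, corrZ_zero, ← intervalIntegral.integral_const_mul,
    ← intervalIntegral.integral_sub, cutoffCurrent]
  · congr 1
    ext ω
    rw [re_respL_one, normSq_respR_one]
    ring
  · exact p.intervalIntegrable_noiseL_mul (Complex.continuous_re.comp hL) Ω
  · exact ((p.intervalIntegrable_noiseL_mul (Complex.continuous_normSq.comp hL) Ω).add
      (p.intervalIntegrable_noiseR_mul (Complex.continuous_normSq.comp hR) Ω)).const_mul _

lemma corrR_sub_eq_cutoffCurrent (Ω : ℝ) :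
    p.corrR Ω (p.rank + 1) 0 - p.ηR * p.corrZ Ω (p.rank + 1) (p.rank + 1) 0
      = -p.cutoffCurrent Ω := by
  have hL := p.continuous_respL (p.rank + 1)
  have hR := p.continuous_respR (p.rank + 1)
  rw [corrR_zero, corrZ_zero, ← intervalIntegral.integral_const_mul,
    ← intervalIntegral.integral_sub, cutoffCurrent, ← intervalIntegral.integral_neg]
  · congr 1
    ext ω
    rw [re_respR_last, normSq_respL_last]
    ring
  · exact p.intervalIntegrable_noiseR_mul (Complex.continuous_re.comp hR) Ω
  · exact ((p.intervalIntegrable_noiseL_mul (Complex.continuous_normSq.comp hL) Ω).add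
      (p.intervalIntegrable_noiseR_mul (Complex.continuous_normSq.comp hR) Ω)).const_mul _

theorem isCutoffHeatCurrent {Ω : ℝ} (hΩ : 0 < Ω) :
    IsCutoffHeatCurrent.{u} p Ω (p.cutoffCurrent Ω) := by
  intro 𝒜 _ _ _ _ S
  have hN := p.two_le_N
  have hrk : p.rank = 2 * (p.N - 1) := rfl
  have hL := S.exists_relaxation_FL hΩ
  have hR := S.exists_relaxation_FR hΩ
  have e1 : ∀ t, S.mode 1 t = S.V 1 t := S.mode_velocity (j := 0) (by omega)
  have eN : ∀ t, S.mode (p.rank + 1) t = S.V p.N t := fun t => by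
    rw [hrk, S.mode_velocity (by omega), Nat.sub_add_cancel (by omega)]
  have cov : ∀ k ≤ p.rank, _ := fun k hk => S.tendsto_covariance _ _ (p.corrZ Ω) hL hR
    (fun l t' => p.motion_corrZ Ω t' l) (p.corrZ_comm Ω) hk
  constructor
  · have h := (S.tendsto_force_correlation hL (Nat.zero_le _)).sub
      ((cov 0 (Nat.zero_le _)).const_mul p.ηL)
    rw [zero_add, corrL_sub_eq_cutoffCurrent] at h
    refine ((Complex.continuous_ofReal.tendsto _).comp h).congr fun t => ?_
    simp only [Function.comp, e1, LangevinDynamics.powerLeft]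
    rw [S.state.sym_eq_inner (S.V_selfAdjoint _ _) (S.FL_selfAdjoint _),
      S.state.map_mul_self_eq_inner (S.V_selfAdjoint _ _)]
    push_cast
    rfl
  · have h := ((S.tendsto_force_correlation hR le_rfl).sub
      ((cov p.rank le_rfl).const_mul p.ηR)).neg
    rw [corrR_sub_eq_cutoffCurrent, neg_neg] at h
    refine ((Complex.continuous_ofReal.tendsto _).comp h).congr fun t => ?_
    simp only [Function.comp, eN, LangevinDynamics.powerRight]
    rw [S.state.sym_eq_inner (S.V_selfAdjoint _ _) (S.FR_selfAdjoint _),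
      S.state.map_mul_self_eq_inner (S.V_selfAdjoint _ _)]
    push_cast
    rfl

end HarmonicChain

/-! ### The Fourier-transformed equations -/

namespace HarmonicChain

variable {p : HarmonicChain}

/-- A transfer argument from the left end to the right end, free of division by `ω` or `den`, so
that it makes sense for vector-valued amplitudes. -/
lemma FourierLangevin.den_smul {E : Type v} [AddCommGroup E] [Module ℂ E] {ω : ℝ} {X : ℕ → E}
    {FL FR : E} (h : p.FourierLangevin ω X FL FR) :
    p.den ω • ((-(Complex.I * ω)) • X 1) = (1 / (p.m * p.ω₀) : ℂ) •
      (chainNum p.rank p.αR (ω / (2 * p.ω₀) : ℝ) • FL + FR) := by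
  obtain ⟨hl, hb, hr⟩ := h
  have hN := p.two_le_N
  have hrk : p.rank = 2 * (p.N - 1) := rfl
  have hm : (p.m : ℂ) ≠ 0 := by exact_mod_cast p.m_pos.ne'
  have hw : (p.ω₀ : ℂ) ≠ 0 := by exact_mod_cast p.ω₀_pos.ne'
  have hηL : (p.ηL : ℂ) / p.m = 2 * p.αL * p.ω₀ := by exact_mod_cast p.ηL_div_m
  have hηR : (p.ηR : ℂ) / p.m = 2 * p.αR * p.ω₀ := by exact_mod_cast p.ηR_div_m
  unfold den
  have hs : (ω : ℂ) = 2 * p.ω₀ * ((ω / (2 * p.ω₀) : ℝ) : ℂ) := by push_cast; field_simp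
  generalize ((ω / (2 * p.ω₀) : ℝ) : ℂ) = s at hs ⊢
  have hrec' := chainPoly_add_two s p.rank
  have hIω : Complex.I * ω = p.ω₀ * (2 * Complex.I * s) := by rw [hs]; ring
  have hω2 : (ω : ℂ) ^ 2 = -(p.ω₀ * (2 * Complex.I * s)) ^ 2 := by
    rw [← hIω, mul_pow, Complex.I_sq]; ring
  rw [mul_div_assoc, hηL, hω2, hIω] at hl
  rw [mul_div_assoc, hηR, hω2, hIω] at hr
  simp only [hω2] at hb
  rw [hIω]
  have hrec2 := chainPoly_add_two s (p.rank - 1)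
  rw [show p.rank - 1 + 2 = p.rank + 1 by omega, show p.rank - 1 + 1 = p.rank by omega] at hrec2
  have sol' := recursion_eq_chainPoly (E := E) s
  -- From here on frequency and imaginary unit enter only through `σ`, so no relation on `Complex.I`
  -- is needed.
  generalize 2 * Complex.I * s = σ at hl hb hr sol' hrec' hrec2 ⊢
  -- The entry `y 0` is a ghost value chosen to make the forced, damped left row an ordinary step of
  -- the recursion.
  set y : ℕ → E := fun k => k.casesOn
    ((2 * p.αL : ℂ) • (-(p.ω₀ * σ)) • X 1 - (1 / (p.m * p.ω₀) : ℂ) • FL)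
    fun k => if Even k then (-(p.ω₀ * σ)) • X (k / 2 + 1)
      else (p.ω₀ : ℂ) • (X (k / 2 + 2) - X (k / 2 + 1)) with hy
  have y0 : y 0 = (2 * p.αL : ℂ) • (-(p.ω₀ * σ)) • X 1
      - (1 / (p.m * p.ω₀) : ℂ) • FL := rfl
  have yo : ∀ j, y (2 * j + 1) = (-(p.ω₀ * σ)) • X (j + 1) := fun j => by
    simp [hy]
  have ye : ∀ j, y (2 * j + 2) = (p.ω₀ : ℂ) • (X (j + 2) - X (j + 1)) := fun j => by
    have : (2 * j + 1) / 2 = j := by omega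
    simp [hy, this]
  have y1 : y 1 = (-(p.ω₀ * σ)) • X 1 := yo 0
  have hrec : ∀ k < p.rank, y (k + 2) = y k - σ • y (k + 1) := by
    intro k hk
    rcases k.even_or_odd' with ⟨j, rfl | rfl⟩
    · rw [ye, yo]
      rcases j with _ | i
      · rw [mul_zero, y0]
        simp only [zero_add]
        linear_combination (norm := skip) (p.ω₀ : ℂ)⁻¹ • hl
        match_scalars <;> field_simp <;> ring
      · rw [show 2 * (i + 1) = 2 * i + 2 by ring, ye]
        have e := hb (i + 2) (by omega) (by omega)
        rw [show i + 2 - 1 = i + 1 by omega] at e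
        simp only [add_assoc, Nat.reduceAdd] at e ⊢
        linear_combination (norm := skip) (p.ω₀ : ℂ)⁻¹ • e
        match_scalars <;> field_simp <;> ring
    · rw [ye, show 2 * j + 1 + 2 = 2 * (j + 1) + 1 by ring, yo, yo]
      module
  have sol := sol' y p.rank hrec
  obtain ⟨q, hq⟩ : ∃ q, p.N = q + 2 := ⟨p.N - 2, by omega⟩
  have hq1 : p.rank = 2 * q + 2 := by omega
  have s1 := sol p.rank le_rfl
  have s2 := sol (2 * q + 1) (by omega)
  rw [show p.rank + 1 = 2 * (q + 1) + 1 by omega, yo, y1, y0,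
    show 2 * (q + 1) + 1 = p.rank + 1 by omega] at s1
  rw [show 2 * q + 1 + 1 = p.rank by omega, hq1, ye, y1, y0, ← hq1] at s2
  rw [show 2 * q + 1 = p.rank - 1 by omega, show chainPoly s (p.rank - 1)
    = chainPoly s (p.rank + 1) + σ * chainPoly s p.rank by rw [hrec2]; ring] at s2
  rw [hq, show q + 2 - 1 = q + 1 by omega] at hr
  rw [chainDen, chainNum, hrec']
  -- The right row contains only the last velocity and the last bond; `s1` and `s2` express them
  -- through `y 1` and `y 0`.
  linear_combination (norm := skip) -(p.ω₀ : ℂ)⁻¹ • hr - (2 * p.αR - σ : ℂ) • s1 - s2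
  match_scalars <;> field_simp <;> ring

variable {θ : ℝ → ℂ}

lemma FourierLangevin.first_eq {E : Type v} [AddCommGroup E] [Module ℂ E] {ω : ℝ} {X : ℕ → E}
    {FL FR : E} (hθ : p.IsBranch θ) (h0 : ω ≠ 0) (hω : |ω| ≠ 2 * p.ω₀)
    (h : p.FourierLangevin ω X FL FR) :
    X 1 = (1 / (p.m * p.ω₀ * ω * p.D (θ ω)) : ℂ) • (p.A (θ ω) • FL + B (θ ω) • FR) := by
  have hm : (p.m : ℂ) ≠ 0 := by exact_mod_cast p.m_pos.ne'
  have hw : (p.ω₀ : ℂ) ≠ 0 := by exact_mod_cast p.ω₀_pos.ne'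
  have h0' : (ω : ℂ) ≠ 0 := by exact_mod_cast h0
  have hc := hθ.cos_ne_zero hω
  have hd := p.den_ne_zero ω
  have e := h.den_smul
  have e1 : X 1 = (-(Complex.I * ω * p.den ω)⁻¹) • p.den ω • ((-(Complex.I * ω)) • X 1) := by
    rw [smul_smul, smul_smul]
    have : -(Complex.I * ω * p.den ω)⁻¹ * p.den ω * -(Complex.I * ω) = 1 := by
      have := Complex.I_ne_zero
      field_simp
    rw [mul_assoc] at this
    rw [mul_assoc, this, one_smul]
  rw [hθ.D_eq, A_eq_chainNum, hθ.sin_eq, B]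
  rw [e] at e1
  rw [e1]
  have := Complex.I_ne_zero
  match_scalars <;> field_simp

/-! ### The spectral density of the current -/

/-- The spectral density of the stationary heat current. -/
def flux (p : HarmonicChain) (ω : ℝ) : ℝ :=
  ω * (realCoth (p.hbar / (2 * p.kB * p.TL) * ω) - realCoth (p.hbar / (2 * p.kB * p.TR) * ω))
    / Complex.normSq (p.den ω)

lemma conj_den (p : HarmonicChain) (ω : ℝ) : conj (p.den ω) = p.den (-ω) := by
  rw [den, conj_chainDen, den]
  congr 1
  push_cast
  ring

lemma flux_neg (p : HarmonicChain) (ω : ℝ) : p.flux (-ω) = p.flux ω := by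
  rw [flux, flux, ← conj_den, Complex.normSq_conj, mul_neg, mul_neg, realCoth_neg, realCoth_neg]
  ring

/-- The cosines in `B` cancel those in `D`, for any branch, and `I ^ 2 = -1` reverses the order of
the two reservoirs. -/
lemma IsBranch.fluxIntegrand_eq (hθ : p.IsBranch θ) {ω : ℝ} (hω : |ω| ≠ 2 * p.ω₀) :
    p.fluxIntegrand θ ω = p.flux ω := by
  have hc := hθ.cos_ne_zero hω
  have hc' := hθ.cos_ne_zero (ω := -ω) (by rwa [abs_neg])
  have hd := p.den_ne_zero ω
  have hd' := p.den_ne_zero (-ω)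
  have hI := Complex.I_ne_zero
  rw [fluxIntegrand, hθ.D_eq, hθ.D_eq, B, B, flux]
  push_cast
  rw [← Complex.mul_conj, conj_den]
  have e : ∀ T : ℝ, p.hbar * ω / (2 * p.kB * T) = p.hbar / (2 * p.kB * T) * ω := fun T => by ring
  rw [e, e]
  have h2 : Complex.I ^ 2 = -1 := Complex.I_sq
  field_simp
  rw [h2]
  ring

lemma IsBranch.fluxIntegrand_ae_eq (hθ : p.IsBranch θ) :
    p.fluxIntegrand θ =ᵐ[volume] fun ω => (p.flux ω : ℂ) := by
  have h : ∀ᵐ ω : ℝ, ω ∉ ({2 * p.ω₀, -(2 * p.ω₀)} : Set ℝ) :=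
    measure_eq_zero_iff_ae_notMem.1 (Set.Finite.measure_zero (Set.toFinite _) volume)
  filter_upwards [h] with ω hω
  refine hθ.fluxIntegrand_eq fun h => hω ?_
  rcases abs_choice ω with h' | h' <;> rw [h'] at h
  · exact Or.inl h
  · exact Or.inr (by rw [Set.mem_singleton_iff]; linarith)

lemma integrable_exp_neg_mul_abs {c : ℝ} (hc : 0 < c) :
    Integrable fun x : ℝ => Real.exp (-(c * |x|)) := by
  have h : IntegrableOn (fun x : ℝ => Real.exp (-(c * |x|))) (Set.Ioi 0) := by
    refine (exp_neg_integrableOn_Ioi 0 hc).congr_fun (fun x hx => ?_) measurableSet_Ioi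
    simp only [abs_of_pos (Set.mem_Ioi.1 hx), neg_mul]
  have h' : IntegrableOn (fun x : ℝ => Real.exp (-(c * |x|))) (Set.Iic 0) := by
    have := (neg_zero (G := ℝ) ▸ h).comp_neg_Iio
    simp only [abs_neg] at this
    exact (integrableOn_Iic_iff_integrableOn_Iio).2 this
  rw [← integrableOn_univ, ← Set.Iic_union_Ioi (a := (0 : ℝ))]
  exact h'.union h

/-- The numerator decays exponentially by `abs_mul_realCoth_sub_le`, and the denominator is at least
`16 αL αR`. -/
lemma integrable_flux (p : HarmonicChain) : Integrable p.flux := by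
  have hc : ∀ T : ℝ, 0 < T → 0 < p.hbar / (2 * p.kB * T) := fun T hT => by
    have := p.hbar_pos; have := p.kB_pos; positivity
  have hL := hc _ p.TL_pos
  have hR := hc _ p.TR_pos
  have hα : 0 < 16 * p.αL * p.αR := by have := p.αL_pos; have := p.αR_pos; positivity
  have hi := ((integrable_exp_neg_mul_abs hL).div_const (p.hbar / (2 * p.kB * p.TL))).add
    ((integrable_exp_neg_mul_abs hR).div_const (p.hbar / (2 * p.kB * p.TR)))
  refine (hi.div_const (16 * p.αL * p.αR)).mono' ?_ (.of_forall fun ω => ?_)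
  · refine Measurable.aestronglyMeasurable ?_
    refine Measurable.div (measurable_id.mul ?_)
      (Complex.continuous_normSq.comp p.continuous_den).measurable
    exact (measurable_realCoth.comp (measurable_const_mul _)).sub
      (measurable_realCoth.comp (measurable_const_mul _))
  · rw [flux, Real.norm_eq_abs, abs_div, abs_of_nonneg (Complex.normSq_nonneg _)]
    have hb := abs_mul_realCoth_sub_le hL hR ω
    exact div_le_div₀ ((abs_nonneg _).trans hb) hb hα
      (chainDen_normSq_ge p.even_rank p.αR_pos _)

lemma cutoffCurrent_eq_integral_flux (p : HarmonicChain) (Ω : ℝ) :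
    p.cutoffCurrent Ω = 2 * p.hbar * p.αL * p.αR / Real.pi * ∫ ω in (-Ω)..Ω, p.flux ω := by
  have e : ∫ ω in (-Ω)..Ω, p.flux ω = 2 * ∫ ω in (0 : ℝ)..Ω, p.flux ω := by
    rw [← intervalIntegral.integral_add_adjacent_intervals (b := 0)
      p.integrable_flux.intervalIntegrable p.integrable_flux.intervalIntegrable]
    have := intervalIntegral.integral_comp_neg (a := 0) (b := Ω) p.flux
    simp only [flux_neg, neg_zero] at this
    rw [← this]
    ring
  have h1 := p.m_pos
  have h2 := p.ω₀_pos
  have hn : ∀ ω, 0 < Complex.normSq (p.den ω) := fun ω => Complex.normSq_pos.2 (p.den_ne_zero ω)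
  rw [e, cutoffCurrent, ← mul_assoc, ← intervalIntegral.integral_const_mul]
  congr 1
  ext ω
  have := hn ω
  have a : ∀ T : ℝ, p.hbar * ω / (2 * p.kB * T) = p.hbar / (2 * p.kB * T) * ω := fun T => by ring
  rw [transmission, noiseWeight, noiseWeight, flux, αL, αR, a, a]
  have := Real.pi_pos
  field_simp

end HarmonicChain

/-! ### The contour integral -/

lemma complexCoth_ofReal (x : ℝ) : complexCoth x = realCoth x := by
  simp [complexCoth, realCoth]

namespace HarmonicChain

variable (p : HarmonicChain)

/-- On the part of the complex `θ` plane where the frequency is real, the integrand in `θ` is the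
pull-back of the spectral density of the current. -/
lemma contourIntegrand_eq {θ : ℂ} {σ : ℝ} (h : Complex.sin (θ / 2) = σ) :
    p.contourIntegrand θ
      = (1 / (2 * p.ω₀) : ℝ) * (Complex.cos (θ / 2) * (p.flux (2 * p.ω₀ * σ) : ℂ)) := by
  have hw := p.ω₀_pos
  have hwc : (p.ω₀ : ℂ) ≠ 0 := by exact_mod_cast hw.ne'
  -- At the band edges the denominator vanishes as well, but the numerator is `0`, so both sides are
  -- `0`.
  by_cases hc : Complex.cos (θ / 2) = 0
  · simp [contourIntegrand, hc]
  have hσ : 2 * p.ω₀ * σ / (2 * p.ω₀) = σ := by field_simp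
  have hd := p.den_ne_zero (2 * p.ω₀ * σ)
  have hd' := p.den_ne_zero (-(2 * p.ω₀ * σ))
  have hD := p.D_eq_chainDen θ
  have hD' := p.D_eq_chainDen (-θ)
  rw [neg_div, Complex.cos_neg, Complex.sin_neg, h] at hD'
  rw [h] at hD
  have e1 : chainDen p.rank p.αL p.αR σ = p.den (2 * p.ω₀ * σ) := by rw [den, hσ]
  have e2 : chainDen p.rank p.αL p.αR (-(σ : ℂ)) = p.den (-(2 * p.ω₀ * σ)) := by
    rw [den, neg_div, hσ, Complex.ofReal_neg]
  rw [e1] at hD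
  rw [e2] at hD'
  -- The denominator is `-D(θ) D(-θ)`: the sine terms of `D` are odd and the cosine term is even, so
  -- the product is a difference of squares.
  have hden : (Complex.sin ((p.N : ℂ) * θ) + 4 * p.αL * p.αR * Complex.sin (((p.N : ℂ) - 1) * θ)) ^ 2
      + 4 * ((p.αL : ℂ) + p.αR) ^ 2 * Complex.cos (((p.N : ℂ) - 1 / 2) * θ) ^ 2
      = Complex.cos (θ / 2) ^ 2 * (p.den (2 * p.ω₀ * σ) * p.den (-(2 * p.ω₀ * σ))) := by
    have e : Complex.cos (θ / 2) ^ 2 * (p.den (2 * p.ω₀ * σ) * p.den (-(2 * p.ω₀ * σ)))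
        = -(p.D θ * p.D (-θ)) := by
      rw [hD, hD']
      linear_combination (Complex.cos (θ / 2) ^ 2 *
        (p.den (2 * p.ω₀ * σ) * p.den (-(2 * p.ω₀ * σ)))) * Complex.I_mul_I
    rw [e, D, D]
    simp only [mul_neg, Complex.sin_neg, Complex.cos_neg]
    linear_combination (4 * ((p.αL : ℂ) + p.αR) ^ 2 * Complex.cos (((p.N : ℂ) - 1 / 2) * θ) ^ 2)
      * Complex.I_mul_I
  have hcoth : ∀ T : ℝ, complexCoth (p.hbar * p.ω₀ / (p.kB * T) * σ)
      = realCoth (p.hbar / (2 * p.kB * T) * (2 * p.ω₀ * σ)) := by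
    intro T
    rw [← complexCoth_ofReal]
    congr 1
    push_cast
    by_cases hk : (p.kB : ℂ) * T = 0
    · rw [hk, mul_assoc 2, hk]; simp
    · rw [mul_assoc 2]; field_simp
  rw [contourIntegrand, hden, h, hcoth, hcoth, flux]
  push_cast
  rw [← Complex.mul_conj, conj_den]
  field_simp

/-- Change of variables on the real part of the contour. -/
lemma sin_substitution :
    IntegrableOn (fun x => (p.ω₀ * Real.cos (x / 2)) • p.flux (2 * p.ω₀ * Real.sin (x / 2)))
      (Set.Icc (-Real.pi) Real.pi) ∧
    ∫ x in Set.Icc (-Real.pi) Real.pi,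
      (p.ω₀ * Real.cos (x / 2)) • p.flux (2 * p.ω₀ * Real.sin (x / 2))
      = ∫ ω in Set.Icc (-(2 * p.ω₀)) (2 * p.ω₀), p.flux ω := by
  have hw := p.ω₀_pos
  have hd : ∀ x ∈ Set.Ioo (-Real.pi) Real.pi,
      HasDerivAt (fun x => 2 * p.ω₀ * Real.sin (x / 2)) (p.ω₀ * Real.cos (x / 2)) x := by
    intro x _
    exact ((((hasDerivAt_id x).div_const 2).sin).const_mul (2 * p.ω₀)).congr_deriv
      (by simp only [id]; ring)
  have hpos : ∀ x ∈ Set.Ioo (-Real.pi) Real.pi, 0 ≤ p.ω₀ * Real.cos (x / 2) := by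
    intro x hx
    exact mul_nonneg hw.le (Real.cos_nonneg_of_mem_Icc ⟨by linarith [hx.1], by linarith [hx.2]⟩)
  have hcont : ContinuousOn (fun x => 2 * p.ω₀ * Real.sin (x / 2))
      (Set.Icc (-Real.pi) Real.pi) := by fun_prop
  have hab : -Real.pi ≤ Real.pi := by linarith [Real.pi_pos]
  have e1 : 2 * p.ω₀ * Real.sin (-Real.pi / 2) = -(2 * p.ω₀) := by
    rw [neg_div, Real.sin_neg, Real.sin_pi_div_two]; ring
  have e2 : 2 * p.ω₀ * Real.sin (Real.pi / 2) = 2 * p.ω₀ := by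
    rw [Real.sin_pi_div_two]; ring
  constructor
  · exact (integrableOn_Icc_deriv_smul_iff_of_deriv_nonneg hcont hd hpos hab).2
      p.integrable_flux.integrableOn
  · rw [integral_Icc_deriv_smul_of_deriv_nonneg hcont hd hpos hab, e1, e2]

/-- Change of variables on the vertical parts of the contour. -/
lemma cosh_substitution :
    IntegrableOn (fun x => (p.ω₀ * Real.sinh (x / 2)) • p.flux (2 * p.ω₀ * Real.cosh (x / 2)))
      (Set.Ioi 0) ∧
    ∫ x in Set.Ioi (0 : ℝ), (p.ω₀ * Real.sinh (x / 2)) • p.flux (2 * p.ω₀ * Real.cosh (x / 2))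
      = ∫ ω in Set.Ioi (2 * p.ω₀), p.flux ω := by
  have hw := p.ω₀_pos
  have hd : ∀ x ∈ Set.Ioi (0 : ℝ), HasDerivWithinAt (fun x => 2 * p.ω₀ * Real.cosh (x / 2))
      (p.ω₀ * Real.sinh (x / 2)) (Set.Ioi 0) x := by
    intro x _
    exact (((((hasDerivAt_id x).div_const 2).cosh).const_mul (2 * p.ω₀)).congr_deriv
      (by simp only [id]; ring)).hasDerivWithinAt
  have hmono : MonotoneOn (fun x => 2 * p.ω₀ * Real.cosh (x / 2)) (Set.Ioi 0) := by
    intro x hx y hy hxy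
    have hx' : 0 < x := hx
    have hy' : 0 < y := hy
    refine mul_le_mul_of_nonneg_left (Real.cosh_le_cosh.2 ?_) (by positivity)
    rw [abs_of_pos (by positivity), abs_of_pos (by positivity)]
    linarith
  have himg : (fun x => 2 * p.ω₀ * Real.cosh (x / 2)) '' Set.Ioi 0 = Set.Ioi (2 * p.ω₀) := by
    ext y
    simp only [Set.mem_image, Set.mem_Ioi]
    constructor
    · rintro ⟨x, hx, rfl⟩
      have := Real.one_lt_cosh.2 (by positivity : x / 2 ≠ 0)
      nlinarith
    · intro hy
      have h1 : 1 < y / (2 * p.ω₀) := by rwa [one_lt_div (by positivity)]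
      refine ⟨2 * Real.arcosh (y / (2 * p.ω₀)), by have := Real.arcosh_pos h1; positivity, ?_⟩
      rw [mul_div_cancel_left₀ _ two_ne_zero, Real.cosh_arcosh h1.le]
      field_simp
  constructor
  · rw [← integrableOn_image_iff_integrableOn_deriv_smul_of_monotoneOn measurableSet_Ioi hd hmono]
    exact p.integrable_flux.integrableOn
  · rw [← integral_image_eq_integral_deriv_smul_of_monotoneOn measurableSet_Ioi hd hmono, himg]

lemma integral_flux_split : ∫ ω, p.flux ω
    = (∫ ω in Set.Icc (-(2 * p.ω₀)) (2 * p.ω₀), p.flux ω)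
      + 2 * ∫ ω in Set.Ioi (2 * p.ω₀), p.flux ω := by
  have hw := p.ω₀_pos
  have hi := p.integrable_flux
  have h1 := intervalIntegral.integral_Iic_add_Ioi (b := -(2 * p.ω₀)) hi.integrableOn hi.integrableOn
  have h2 := intervalIntegral.integral_interval_add_Ioi (a := -(2 * p.ω₀)) (b := 2 * p.ω₀)
    (f := p.flux) (μ := volume) hi.integrableOn hi.integrableOn
  have h3 := integral_comp_neg_Ioi (2 * p.ω₀) p.flux
  simp only [flux_neg] at h3
  rw [intervalIntegral.integral_of_le (by linarith), ← integral_Icc_eq_integral_Ioc] at h2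
  linarith

lemma contourIntegrand_real (x : ℝ) : p.contourIntegrand x = ((1 / (2 * p.ω₀ ^ 2) *
    ((p.ω₀ * Real.cos (x / 2)) • p.flux (2 * p.ω₀ * Real.sin (x / 2))) : ℝ) : ℂ) := by
  have hw : (p.ω₀ : ℂ) ≠ 0 := by exact_mod_cast p.ω₀_pos.ne'
  rw [p.contourIntegrand_eq (σ := Real.sin (x / 2)) (by push_cast; rfl)]
  push_cast [smul_eq_mul]
  field_simp

/-- On this leg `sin (θ/2) = cosh (x/2)` is real and `cos (θ/2) = -i s₂ sinh (x/2)`. The factor `i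
s₂` of `dθ` leaves only `s₂² = 1`, so the direction of the leg is irrelevant. -/
lemma contourIntegrand_right {s₂ : ℝ} (hs : s₂ = 1 ∨ s₂ = -1) (x : ℝ) :
    Complex.I * s₂ * p.contourIntegrand (Real.pi + Complex.I * s₂ * x) = ((1 / (2 * p.ω₀ ^ 2) *
      ((p.ω₀ * Real.sinh (x / 2)) • p.flux (2 * p.ω₀ * Real.cosh (x / 2))) : ℝ) : ℂ) := by
  have hw : (p.ω₀ : ℂ) ≠ 0 := by exact_mod_cast p.ω₀_pos.ne'
  have e : ((Real.pi : ℂ) + Complex.I * s₂ * x) / 2 = s₂ * (x / 2) * Complex.I + Real.pi / 2 := by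
    ring
  have hsin : Complex.sin (((Real.pi : ℂ) + Complex.I * s₂ * x) / 2) = (Real.cosh (x / 2) : ℝ) := by
    rw [e, Complex.sin_add_pi_div_two, Complex.cos_mul_I]
    rcases hs with rfl | rfl <;> simp
  have hcos : Complex.cos (((Real.pi : ℂ) + Complex.I * s₂ * x) / 2)
      = -(s₂ * Complex.sinh (x / 2) * Complex.I) := by
    rw [e, Complex.cos_add_pi_div_two, Complex.sin_mul_I]
    rcases hs with rfl | rfl <;> simp
  rw [p.contourIntegrand_eq hsin, hcos]
  have h2 : (s₂ : ℂ) ^ 2 = 1 := by rcases hs with rfl | rfl <;> simp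
  push_cast [smul_eq_mul]
  field_simp
  rw [h2, Complex.I_sq]
  ring

/-- Here `sin (θ/2) = -cosh (x/2)`; evenness of `flux` folds this leg onto `ω > 2 ω₀`, and the minus
sign compensates the reversed orientation of the leg. -/
lemma contourIntegrand_left {s₁ : ℝ} (hs : s₁ = 1 ∨ s₁ = -1) (x : ℝ) :
    Complex.I * s₁ * p.contourIntegrand (-Real.pi + Complex.I * s₁ * x) = -((1 / (2 * p.ω₀ ^ 2) *
      ((p.ω₀ * Real.sinh (x / 2)) • p.flux (2 * p.ω₀ * Real.cosh (x / 2))) : ℝ) : ℂ) := by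
  have hw : (p.ω₀ : ℂ) ≠ 0 := by exact_mod_cast p.ω₀_pos.ne'
  have e : (-(Real.pi : ℂ) + Complex.I * s₁ * x) / 2 = s₁ * (x / 2) * Complex.I - Real.pi / 2 := by
    ring
  have hsin : Complex.sin ((-(Real.pi : ℂ) + Complex.I * s₁ * x) / 2)
      = (-Real.cosh (x / 2) : ℝ) := by
    rw [e, Complex.sin_sub_pi_div_two, Complex.cos_mul_I]
    rcases hs with rfl | rfl <;> simp
  have hcos : Complex.cos ((-(Real.pi : ℂ) + Complex.I * s₁ * x) / 2)
      = s₁ * Complex.sinh (x / 2) * Complex.I := by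
    rw [e, Complex.cos_sub_pi_div_two, Complex.sin_mul_I]
    rcases hs with rfl | rfl <;> simp
  rw [p.contourIntegrand_eq hsin, hcos, mul_neg, flux_neg]
  have h2 : (s₁ : ℂ) ^ 2 = 1 := by rcases hs with rfl | rfl <;> simp
  push_cast [smul_eq_mul]
  field_simp
  rw [h2, Complex.I_sq]
  ring

/-- A unimodular factor does not affect integrability. -/
lemma integrableOn_of_unit_mul {f : ℝ → ℂ} {g : ℝ → ℝ} {s : Set ℝ} {z : ℂ} {c : ℝ} (hz : z ≠ 0)
    (h : ∀ x, z * f x = ((c * g x : ℝ) : ℂ)) (hg : IntegrableOn g s) : IntegrableOn f s := by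
  have : f = fun x => z⁻¹ * ((c * g x : ℝ) : ℂ) := by
    ext x; rw [← h, inv_mul_cancel_left₀ hz]
  rw [this]
  exact ((hg.const_mul c).ofReal).const_mul _

theorem contourIntegral_eq {s₁ s₂ : ℝ} (hs₁ : s₁ = 1 ∨ s₁ = -1) (hs₂ : s₂ = 1 ∨ s₂ = -1) :
    ContourIntegrable p.contourIntegrand s₁ s₂ ∧
    contourIntegral p.contourIntegrand s₁ s₂
      = ((1 / (2 * p.ω₀ ^ 2) * ∫ ω, p.flux ω : ℝ) : ℂ) := by
  have hI : ∀ s : ℝ, s = 1 ∨ s = -1 → Complex.I * s ≠ 0 := by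
    rintro s (rfl | rfl) <;> simp
  have hπ : -Real.pi ≤ Real.pi := by linarith [Real.pi_pos]
  obtain ⟨ic, ec⟩ := p.cosh_substitution
  obtain ⟨is, es⟩ := p.sin_substitution
  refine ⟨⟨?_, ?_, ?_⟩, ?_⟩
  · refine integrableOn_of_unit_mul (c := -(1 / (2 * p.ω₀ ^ 2))) (hI s₁ hs₁) (fun x => ?_) ic
    rw [p.contourIntegrand_left hs₁]
    push_cast
    ring
  · rw [intervalIntegrable_iff_integrableOn_Icc_of_le hπ]
    refine integrableOn_of_unit_mul (c := 1 / (2 * p.ω₀ ^ 2)) one_ne_zero (fun x => ?_) is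
    rw [one_mul, p.contourIntegrand_real]
  · exact integrableOn_of_unit_mul (c := 1 / (2 * p.ω₀ ^ 2)) (hI s₂ hs₂)
      (fun x => p.contourIntegrand_right hs₂ x) ic
  · unfold contourIntegral
    rw [← integral_const_mul, ← integral_const_mul, intervalIntegral.integral_of_le hπ,
      ← integral_Icc_eq_integral_Ioc]
    simp only [p.contourIntegrand_left hs₁, p.contourIntegrand_right hs₂, p.contourIntegrand_real]
    rw [integral_neg, neg_neg, integral_complex_ofReal, integral_complex_ofReal,
      integral_const_mul, integral_const_mul, ec, es, p.integral_flux_split]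
    push_cast
    ring

end HarmonicChain

end

theorem mainTheorem1 (p : HarmonicChain) (θ : ℝ → ℂ) (hθ : p.IsBranch θ) :
    -- the denominator does not vanish on the real frequency axis away from the band edges
    (∀ ω : ℝ, |ω| ≠ 2 * p.ω₀ → p.D (θ ω) ≠ 0) ∧
    -- solution of the Fourier-transformed equations for the first mass
    (∀ (E : Type v) [AddCommGroup E] [Module ℂ E] (ω : ℝ) (X : ℕ → E) (FL FR : E),
      ω ≠ 0 → |ω| ≠ 2 * p.ω₀ → p.FourierLangevin ω X FL FR →
      X 1 = (1 / (p.m * p.ω₀ * ω * p.D (θ ω)) : ℂ) •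
        (p.A (θ ω) • FL + HarmonicChain.B (θ ω) • FR)) ∧
    -- cancellation identity
    (∀ ω : ℝ, |ω| ≠ 2 * p.ω₀ →
      (4 * p.αL * p.A (θ ω) * conj (p.A (θ ω))
          - Complex.I * p.D (θ ω) * conj (p.A (θ ω))
          + Complex.I * conj (p.D (θ ω)) * p.A (θ ω))
        / (4 * p.αR * HarmonicChain.B (θ ω) * conj (HarmonicChain.B (θ ω))) = -1) ∧
    -- stationary heat current: long-time limit at fixed cutoff, then removal of the cutoff
    Integrable (p.fluxIntegrand θ) ∧
    ∃ (Jcut : ℝ → ℝ) (J : ℝ),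
      (∀ Ω : ℝ, 0 < Ω →
        HarmonicChain.IsCutoffHeatCurrent.{u} p Ω (Jcut Ω) ∧
        (Jcut Ω : ℂ) = 2 * p.hbar * p.αL * p.αR / Real.pi *
          ∫ ω in (-Ω)..Ω, p.fluxIntegrand θ ω) ∧
      Tendsto Jcut atTop (𝓝 J) ∧
      (J : ℂ) = 2 * p.hbar * p.αL * p.αR / Real.pi * ∫ ω : ℝ, p.fluxIntegrand θ ω ∧
      -- the same current as a contour integral, for each of the four admissible contours
      ∀ s₁ s₂ : ℝ, (s₁ = 1 ∨ s₁ = -1) → (s₂ = 1 ∨ s₂ = -1) →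
        ContourIntegrable p.contourIntegrand s₁ s₂ ∧
        (J : ℂ) = 4 * p.hbar * p.ω₀ ^ 2 * p.αL * p.αR / Real.pi *
          contourIntegral p.contourIntegrand s₁ s₂ := by
  have hae := hθ.fluxIntegrand_ae_eq
  have hw : (p.ω₀ : ℂ) ≠ 0 := by exact_mod_cast p.ω₀_pos.ne'
  refine ⟨fun ω hω => hθ.D_ne_zero hω, fun E _ _ ω X FL FR h0 hω h => h.first_eq hθ h0 hω,
    fun ω hω => hθ.cancellation hω, (integrable_congr hae).2 p.integrable_flux.ofReal,
    p.cutoffCurrent, 2 * p.hbar * p.αL * p.αR / Real.pi * ∫ ω, p.flux ω,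
    fun Ω hΩ => ⟨p.isCutoffHeatCurrent hΩ, ?_⟩, ?_, ?_, fun s₁ s₂ hs₁ hs₂ => ?_⟩
  · rw [intervalIntegral.integral_congr_ae (hae.mono fun ω h _ => h),
      intervalIntegral.integral_ofReal, p.cutoffCurrent_eq_integral_flux]
    push_cast
    rfl
  · simp only [funext p.cutoffCurrent_eq_integral_flux]
    exact (intervalIntegral_tendsto_integral p.integrable_flux tendsto_neg_atTop_atBot
      tendsto_id).const_mul _
  · rw [integral_congr_ae hae, integral_complex_ofReal]
    push_cast
    rfl
  · obtain ⟨hi, he⟩ := p.contourIntegral_eq hs₁ hs₂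
    refine ⟨hi, ?_⟩
    rw [he]
    push_cast
    field_simp
    ring
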